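/- Let $\mathcal{E}=\mathbb{Z}[\omega]$, $\omega=\frac{-1+\sqrt{-3}}{2}$, be the ring of Eisenstein integers and $\theta=\omega-\bar\omega=\sqrt{-3}$. An $\mathcal{E}$-lattice is a finitely generated free $\mathcal{E}$-module $L$ with an $\mathcal{E}$-valued Hermitian form $\langle\cdot,\cdot\rangle$, linear in the first and antilinear in the second argument; its signature is that of the induced Hermitian form on $L\otimes_{\mathcal{E}}\mathbb{C}$ (a lattice of signature $(p,n)$ is nondegenerate, of rank $p+n$), and its dual is $L'=\{v\in L\otimes_{\mathcal{E}}\mathbb{C} : \langle L,v\rangle\subseteq\mathcal{E}\}$. Isomorphisms of lattices are $\mathcal{E}$-linear isomorphisms preserving the forms, and $\operatorname{Aut} L$ is the group of automorphisms of $L$. A null vector is a vector $\rho$ with $\langle\rho,\rho\rangle=0$; it is primitive if it is nonzero and $\rho=a x$ with $a\in\mathcal{E}$, $x\in L$ only for units $a$. Let $p,n>0$ be integers with $p-n\equiv 0\pmod 4$, and let $L_{p,n}$ be the $\mathcal{E}$-lattice, unique up to isomorphism, of signature $(p,n)$ satisfying $L_{p,n}=\theta L_{p,n}'$. 1. If $\rho\in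 L_{p,n}$ is a primitive null vector, then $L:=\rho^\perp/\langle\rho\rangle$, with the induced form, is an $\mathcal{E}$-lattice of signature $(p-1,n-1)$ that satisfies $L=\theta L'$. 2. Every $\mathcal{E}$-lattice $L$ of signature $(p-1,n-1)$ with $L=\theta L'$ is isomorphic to $\rho^\perp/\langle\rho\rangle$ for some primitive null vector $\rho\in L_{p,n}$. 3. Two primitive null vectors $\rho_1,\rho_2$ of $L_{p,n}$ are equivalent under $\operatorname{Aut} L_{p,n}$ if and only if $\rho_1^\perp/\langle\rho_1\rangle\cong\rho_2^\perp/\langle\rho_2\rangle$. -/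

import Mathlib

open scoped TensorProduct ComplexConjugate

noncomputable section

/-- The ring of Eisenstein integers `ℤ[ω]`, `ω ^ 2 = -1 - ω`: the element `⟨a, b⟩` is `a + b * ω`.
Its `star` is complex conjugation (see `Eisenstein.toComplex_star`). -/
abbrev Eisenstein : Type := QuadraticAlgebra ℤ (-1) (-1)

namespace Eisenstein

/-- The primitive cube root of unity `ω`. -/
def ω : Eisenstein := ⟨0, 1⟩

/-- `θ = ω - conj ω`, a square root of `-3`. -/
def θ : Eisenstein := ω - star ω

/-- The complex number `(-1 + i √3) / 2`. -/
def omegaC : ℂ := ⟨-1 / 2, Real.sqrt 3 / 2⟩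

theorem omegaC_mul_self : omegaC * omegaC = (-1 : ℤ) • (1 : ℂ) + (-1 : ℤ) • omegaC := by
  have h : Real.sqrt 3 * Real.sqrt 3 = 3 := Real.mul_self_sqrt (by norm_num)
  apply Complex.ext
  · simp [omegaC]; nlinarith
  · simp [omegaC]; ring

/-- The embedding of the Eisenstein integers in `ℂ`. -/
def toComplex : Eisenstein →+* ℂ :=
  ((QuadraticAlgebra.lift ⟨omegaC, omegaC_mul_self⟩ : Eisenstein →ₐ[ℤ] ℂ) : Eisenstein →+* ℂ)

instance : Algebra Eisenstein ℂ := toComplex.toAlgebra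

theorem toComplex_apply (z : Eisenstein) :
    algebraMap Eisenstein ℂ z = (z.re : ℂ) + (z.im : ℂ) * omegaC := by
  change toComplex z = _
  simp [toComplex, QuadraticAlgebra.lift]

theorem toComplex_star (z : Eisenstein) :
    algebraMap Eisenstein ℂ (star z) = conj (algebraMap Eisenstein ℂ z) := by
  rw [toComplex_apply, toComplex_apply]
  apply Complex.ext
  · simp [omegaC]; ring
  · simp [omegaC]

end Eisenstein

/-- A Hermitian form with values in the Eisenstein integers, linear in its first argument and
antilinear in its second one. A lattice is a finitely generated free `Eisenstein`-module together
with such a form. -/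
structure HermForm (L : Type*) [AddCommGroup L] [Module Eisenstein L] where
  /-- The underlying sesquilinear form. -/
  form : L →ₗ[Eisenstein] L →ₛₗ[starRingEnd Eisenstein] Eisenstein
  star_form : ∀ x y, star (form x y) = form y x

namespace HermForm

variable {L : Type*} [AddCommGroup L] [Module Eisenstein L]
variable {M : Type*} [AddCommGroup M] [Module Eisenstein M]

/-- For `x : L`, the `ℂ`-linear extension to `ℂ ⊗ L` of the linear form `y ↦ ⟨y, x⟩`. -/
def extendRight (h : HermForm L) (x : L) : (ℂ ⊗[Eisenstein] L) →ₗ[ℂ] ℂ :=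
  LinearMap.liftBaseChange ℂ (Algebra.linearMap Eisenstein ℂ ∘ₗ
    { toFun := fun y => h.form y x
      map_add' := fun y z => by simp
      map_smul' := fun a y => by simp : L →ₗ[Eisenstein] Eisenstein })

@[simp] theorem extendRight_tmul (h : HermForm L) (x : L) (a : ℂ) (y : L) :
    h.extendRight x (a ⊗ₜ y) = a * algebraMap Eisenstein ℂ (h.form y x) := by
  simp [extendRight]

/-- Complex conjugation as a semilinear map. -/
def conjMap : ℂ →ₛₗ[starRingEnd ℂ] ℂ where
  toFun := fun z => conj z
  map_add' := fun _ _ => map_add _ _ _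
  map_smul' := fun _ _ => by simp

/-- For `x : L`, the antilinear form `w ↦ ⟨x, w⟩` on `ℂ ⊗ L`. -/
def extendLeft (h : HermForm L) :
    L →ₗ[Eisenstein] ((ℂ ⊗[Eisenstein] L) →ₛₗ[starRingEnd ℂ] ℂ) where
  toFun := fun x => conjMap.comp (h.extendRight x)
  map_add' := fun x y => by
    ext w
    induction w using TensorProduct.induction_on with
    | zero => simp
    | tmul a z => simp [conjMap, mul_add]
    | add u v hu hv => rw [map_add, map_add, hu, hv]
  map_smul' := fun r x => by
    ext w
    induction w using TensorProduct.induction_on with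
    | zero => simp
    | tmul a z =>
      have : conj (algebraMap Eisenstein ℂ (star r)) = algebraMap Eisenstein ℂ r := by
        rw [← Eisenstein.toComplex_star, star_star]
      simp [conjMap, Algebra.smul_def, starRingEnd_apply r, this]
      ring
    | add u v hu hv => rw [map_add, map_add, hu, hv]

/-- The Hermitian form on the complex vector space `ℂ ⊗ L`
extending the one on `L`. -/
def complexForm (h : HermForm L) :
    (ℂ ⊗[Eisenstein] L) →ₗ[ℂ] (ℂ ⊗[Eisenstein] L) →ₛₗ[starRingEnd ℂ] ℂ :=
  LinearMap.liftBaseChange ℂ h.extendLeft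

@[simp] theorem complexForm_tmul_tmul (h : HermForm L) (a b : ℂ) (x y : L) :
    h.complexForm (a ⊗ₜ x) (b ⊗ₜ y) = a * conj b * algebraMap Eisenstein ℂ (h.form x y) := by
  simp [complexForm, extendLeft, conjMap, ← Eisenstein.toComplex_star, h.star_form, mul_assoc]

/-- The Hermitian form on `ℂ ⊗ L` is nondegenerate of signature `(p, n)`: there is an orthogonal
basis with `p` vectors of norm `1` and `n` vectors of norm `-1`. -/
def HasSignature (h : HermForm L) (p n : ℕ) : Prop :=
  ∃ b : Module.Basis (Fin p ⊕ Fin n) ℂ (ℂ ⊗[Eisenstein] L),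
    (∀ i j, i ≠ j → h.complexForm (b i) (b j) = 0) ∧
    (∀ i, h.complexForm (b (Sum.inl i)) (b (Sum.inl i)) = 1) ∧
    (∀ j, h.complexForm (b (Sum.inr j)) (b (Sum.inr j)) = -1)

/-- The dual lattice `L'`: all `v` in `ℂ ⊗ L` with `⟨L, v⟩` contained in the Eisenstein
integers. -/
def dual (h : HermForm L) : Submodule Eisenstein (ℂ ⊗[Eisenstein] L) where
  carrier := {v | ∀ x : L, ∃ c : Eisenstein,
    h.complexForm ((1 : ℂ) ⊗ₜ x) v = algebraMap Eisenstein ℂ c}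
  zero_mem' := fun _ => ⟨0, by simp⟩
  add_mem' := fun {u v} hu hv x => by
    obtain ⟨a, ha⟩ := hu x
    obtain ⟨b, hb⟩ := hv x
    exact ⟨a + b, by rw [map_add, ha, hb, map_add]⟩
  smul_mem' := fun r v hv x => by
    obtain ⟨a, ha⟩ := hv x
    refine ⟨star r * a, ?_⟩
    rw [← algebraMap_smul ℂ r v, LinearMap.map_smulₛₗ, ha, map_mul, Eisenstein.toComplex_star]
    rfl

/-- The image of `L` in `ℂ ⊗ L`. -/
def image (_h : HermForm L) : Submodule Eisenstein (ℂ ⊗[Eisenstein] L) :=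
  LinearMap.range (TensorProduct.mk Eisenstein ℂ L 1)

/-- The condition `L = θ L'`, as an equality of subsets of `ℂ ⊗ L`. -/
def IsThetaSelfDual (h : HermForm L) : Prop :=
  h.image = h.dual.map (LinearMap.lsmul Eisenstein (ℂ ⊗[Eisenstein] L) Eisenstein.θ)

/-- Isometries of lattices: linear isomorphisms preserving the forms. -/
structure Isometry (h : HermForm L) (k : HermForm M) extends L ≃ₗ[Eisenstein] M where
  map_form' : ∀ x y, k.form (toFun x) (toFun y) = h.form x y

/-- The automorphism group of a lattice, as a subgroup of all linear automorphisms. -/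
def aut (h : HermForm L) : Subgroup (L ≃ₗ[Eisenstein] L) where
  carrier := {g | ∀ x y, h.form (g x) (g y) = h.form x y}
  mul_mem' := fun {f g} hf hg x y => (hf (g x) (g y)).trans (hg x y)
  one_mem' := fun _ _ => rfl
  inv_mem' := fun {g} hg x y => by
    have := hg (g.symm x) (g.symm y)
    simp only [LinearEquiv.apply_symm_apply] at this
    exact this.symm

/-- The vector `ρ` is null, i.e. has norm `0`, and primitive, i.e. is divisible by
units only. In particular `ρ ≠ 0`. -/
structure IsPrimitiveNull (h : HermForm L) (ρ : L) : Prop where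
  null : h.form ρ ρ = 0
  primitive : ∀ (a : Eisenstein) (x : L), ρ = a • x → IsUnit a

/-- The orthogonal complement `ρ^⊥`. -/
def perp (h : HermForm L) (ρ : L) : Submodule Eisenstein L where
  carrier := {x | h.form x ρ = 0}
  zero_mem' := by simp
  add_mem' := fun {x y} (hx : h.form x ρ = 0) (hy : h.form y ρ = 0) => by simp [hx, hy]
  smul_mem' := fun r x (hx : h.form x ρ = 0) => by simp [hx]

/-- The span of `ρ`, as a submodule of `ρ^⊥` (which contains it if `ρ` is null). -/
def spanInPerp (h : HermForm L) (ρ : L) : Submodule Eisenstein (h.perp ρ) :=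
  (Submodule.span Eisenstein {ρ}).submoduleOf (h.perp ρ)

/-- The module `ρ^⊥ / ⟨ρ⟩`. -/
abbrev Quot (h : HermForm L) (ρ : L) : Type _ := h.perp ρ ⧸ h.spanInPerp ρ

theorem form_perp_right (h : HermForm L) {ρ : L} (x : h.perp ρ) {z : h.perp ρ}
    (hz : z ∈ h.spanInPerp ρ) : h.form x z = 0 := by
  obtain ⟨c, hc⟩ := Submodule.mem_span_singleton.1 (show (z : L) ∈ Submodule.span Eisenstein {ρ} from hz)
  have hx : h.form x ρ = 0 := x.2
  have hc' : c • ρ = (z : L) := hc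
  rw [← hc', LinearMap.map_smulₛₗ, hx, smul_zero]

/-- For `x` in `ρ^⊥`, the antilinear form on `ρ^⊥ / ⟨ρ⟩` sending the class of `y` to `⟨x, y⟩`. -/
def quotAux (h : HermForm L) (ρ : L) :
    h.perp ρ →ₗ[Eisenstein] (h.Quot ρ →ₛₗ[starRingEnd Eisenstein] Eisenstein) where
  toFun := fun x => (h.spanInPerp ρ).liftQ ((h.form x).comp (h.perp ρ).subtype)
    (fun _ hz => h.form_perp_right x hz)
  map_add' := fun x y => by
    apply LinearMap.ext
    rintro ⟨z⟩
    change h.form ((x : L) + y) z = h.form x z + h.form y z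
    rw [map_add, LinearMap.add_apply]
  map_smul' := fun r x => by
    apply LinearMap.ext
    rintro ⟨z⟩
    change h.form (r • (x : L)) z = r • h.form x z
    rw [map_smul, LinearMap.smul_apply]

/-- The Hermitian form on `ρ^⊥ / ⟨ρ⟩` induced by the one on `L`. -/
def quotForm (h : HermForm L) (ρ : L) : HermForm (h.Quot ρ) where
  form := (h.spanInPerp ρ).liftQ (h.quotAux ρ) (fun z hz => by
    apply LinearMap.ext
    rintro ⟨x⟩
    change h.form z x = 0
    rw [← h.star_form, h.form_perp_right x hz, star_zero])
  star_form := fun x y => by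
    obtain ⟨x, rfl⟩ := Submodule.mkQ_surjective _ x
    obtain ⟨y, rfl⟩ := Submodule.mkQ_surjective _ y
    exact h.star_form (x : L) (y : L)

@[simp] theorem quotForm_mk_mk (h : HermForm L) (ρ : L) (x y : h.perp ρ) :
    (h.quotForm ρ).form (Submodule.Quotient.mk x) (Submodule.Quotient.mk y) = h.form x y := rfl

end HermForm

end

/-! ### Eisenstein integers: the norm and Euclidean division -/

noncomputable section

namespace Eisenstein

/-! A nondegenerate form identifies `L'` with the functionals on `L`, so `L = θL'` says that the
form is divisible by `θ` and every functional is some `⟨·, y⟩ / θ`; this is `IsModular θ`. A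
primitive null vector `ρ` therefore has a partner `y` with `⟨ρ, y⟩ = θ`, and since the traces of
elements of `θE` are all the multiples of 3, `y` can be made null. The plane spanned by `ρ` and `y`
splits off, with complement isometric to `ρ^⊥/⟨ρ⟩` (`exists_isometry_hyp`). Claim 1 follows with
Sylvester's law of inertia, and claim 3 because an isometry of the complements extends by the
identity on the plane.

For claim 2, the sum of a hyperbolic plane and `k` is `θ`-modular with the signature of `h`, so it
suffices that an indefinite `θ`-modular lattice is determined by its signature
(`nonempty_isometry`). Let `K` be maximal among the submodules between `θL` and `L` on which the
form is divisible by 3. Then `K` with the form divided by 3 is unimodular, and multiplication by `θ`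
embeds `L` isometrically in `K` as a submodule that is its own orthogonal complement modulo `θ`, a
Lagrangian (`exists_unimodular`).

Two facts finish the argument. Indefinite unimodular lattices are diagonal with entries `±1`, hence
determined by their signature; this rests on the isotropy of indefinite ternary forms, proved by a
descent in the style of Legendre. And the isometry group is transitive on Lagrangians: modulo `θ`
the form is a quadratic form over the field with three elements, and enough of its reflections lift
to reflections in vectors of norm `±1`. -/

theorem norm_eq (z : Eisenstein) : z.norm = z.re ^ 2 - z.re * z.im + z.im ^ 2 := by
  rw [QuadraticAlgebra.norm_def]; ring

theorem four_mul_norm (z : Eisenstein) : 4 * z.norm = (2 * z.re - z.im) ^ 2 + 3 * z.im ^ 2 := by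
  rw [norm_eq]; ring

theorem norm_nonneg (z : Eisenstein) : 0 ≤ z.norm := by
  nlinarith [four_mul_norm z, sq_nonneg (2 * z.re - z.im), sq_nonneg z.im]

theorem norm_eq_zero {z : Eisenstein} : z.norm = 0 ↔ z = 0 := by
  refine ⟨fun h => ?_, fun h => by rw [h, QuadraticAlgebra.norm_zero]⟩
  have h4 := four_mul_norm z
  have h1 : z.im = 0 := by
    by_contra hne
    have := sq_nonneg (2 * z.re - z.im)
    have := pow_pos (abs_pos.2 hne) 2
    rw [sq_abs] at this
    linarith
  have h2 : z.re = 0 := by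
    rw [norm_eq, h1] at h
    simpa using h
  exact QuadraticAlgebra.ext h2 h1

theorem norm_pos {z : Eisenstein} (hz : z ≠ 0) : 0 < z.norm :=
  lt_of_le_of_ne (norm_nonneg z) fun h => hz (norm_eq_zero.1 h.symm)

theorem mul_star_eq (z : Eisenstein) : z * star z = (z.norm : Eisenstein) :=
  (QuadraticAlgebra.algebraMap_norm_eq_mul_star z).symm

instance : IsDomain Eisenstein :=
  have : NoZeroDivisors Eisenstein := ⟨fun {a b} h => by
    have : a.norm * b.norm = 0 := by rw [← map_mul, h, QuadraticAlgebra.norm_zero]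
    rcases mul_eq_zero.1 this with h | h
    · exact Or.inl (norm_eq_zero.1 h)
    · exact Or.inr (norm_eq_zero.1 h)⟩
  NoZeroDivisors.to_isDomain _

theorem exists_centered (m : ℕ) (hm : 0 < m) (a : ℤ) : ∃ b k : ℤ, a = b + m * k ∧ 2 * |b| ≤ m := by
  refine ⟨a.bmod m, a.bdiv m, ?_, ?_⟩
  · have := Int.bmod_add_bdiv a m
    linarith
  · have h1 := Int.le_bmod (x := a) hm
    have h2 := Int.bmod_lt (x := a) hm
    rw [← abs_two, ← abs_mul, abs_le]
    constructor <;> omega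

theorem four_mul_norm_le {z : Eisenstein} {m : ℤ} (h1 : 2 * |z.re| ≤ m) (h2 : 2 * |z.im| ≤ m) :
    4 * z.norm ≤ 3 * m ^ 2 := by
  have a1 := abs_nonneg z.re
  have a2 := abs_nonneg z.im
  have h3 : -(z.re * z.im) ≤ |z.re| * |z.im| := by
    rw [← abs_mul]; exact neg_le_abs _
  rw [norm_eq, ← sq_abs z.re, ← sq_abs z.im]
  nlinarith

/-- Division with remainder by a positive integer. -/
theorem exists_reduced (m : ℕ) (hm : 0 < m) (z : Eisenstein) :
    ∃ r k : Eisenstein, z = r + m * k ∧ 2 * |r.re| ≤ m ∧ 2 * |r.im| ≤ m := by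
  obtain ⟨a, k, h1, h2⟩ := exists_centered m hm z.re
  obtain ⟨b, l, h3, h4⟩ := exists_centered m hm z.im
  refine ⟨⟨a, b⟩, ⟨k, l⟩, ?_, h2, h4⟩
  apply QuadraticAlgebra.ext
  · simp [h1]
  · simp [h3]

theorem exists_norm_sub_lt (x : Eisenstein) {y : Eisenstein} (hy : y ≠ 0) :
    ∃ q : Eisenstein, (x - q * y).norm < y.norm := by
  have hN := norm_pos hy
  obtain ⟨m, hm⟩ := Int.eq_ofNat_of_zero_le hN.le
  obtain ⟨r, k, h, h1, h2⟩ := exists_reduced m (by omega) (x * star y)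
  refine ⟨k, ?_⟩
  -- Taking norms, `N(x - ky) N(y) = N(r)`, which is at most `(3/4) N(y)²` because both coordinates
  -- of `r` are at most `N(y)/2` in absolute value.
  have hr : r = (x - k * y) * star y := by
    rw [sub_mul, h, mul_assoc, mul_star_eq, hm]
    push_cast
    ring
  have h4 := four_mul_norm_le h1 h2
  rw [← hm, hr, map_mul, QuadraticAlgebra.norm_star] at h4
  nlinarith [norm_nonneg (x - k * y)]

instance : IsPrincipalIdealRing Eisenstein where
  principal I := by
    by_cases hI : ∃ x ∈ I, x ≠ 0
    · have hne : ∃ n : ℕ, ∃ x ∈ I, x ≠ 0 ∧ x.norm.toNat = n := by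
        obtain ⟨x, hx, hx0⟩ := hI
        exact ⟨_, x, hx, hx0, rfl⟩
      classical
      obtain ⟨y, hy, hy0, hyn⟩ := Nat.find_spec hne
      refine ⟨y, le_antisymm (fun x hx => ?_) ?_⟩
      · obtain ⟨q, hq⟩ := exists_norm_sub_lt x hy0
        have hmem : x - q * y ∈ I := I.sub_mem hx (I.mul_mem_left q hy)
        have h0 : x - q * y = 0 := by
          by_contra hne0
          refine Nat.find_min hne ?_ ⟨_, hmem, hne0, rfl⟩
          rw [← hyn]
          have := norm_nonneg (x - q * y)
          omega
        exact Ideal.mem_span_singleton.2 ⟨q, by linear_combination h0⟩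
      · exact (Ideal.span_singleton_le_iff_mem I).2 hy
    · push Not at hI
      exact ⟨0, by
        apply le_antisymm
        · intro x hx
          rw [hI x hx]
          exact Submodule.zero_mem _
        · simp⟩

/-! ### Arithmetic modulo `θ` -/

theorem θ_eq : θ = ⟨1, 2⟩ := by
  apply QuadraticAlgebra.ext <;> simp [θ, ω]

theorem star_θ : star θ = -θ := by simp [θ]

theorem θ_mul_θ : θ * θ = -3 := by
  rw [θ_eq]; rfl

theorem θ_ne_zero : θ ≠ 0 := by
  rw [θ_eq]; intro h; simpa using congrArg QuadraticAlgebra.re h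

/-- Reduction modulo `θ`. -/
def residue : Eisenstein →+* ZMod 3 where
  toFun z := ((z.re + z.im : ℤ) : ZMod 3)
  map_one' := by simp [QuadraticAlgebra.re_one, QuadraticAlgebra.im_one]
  map_zero' := by simp
  map_add' x y := by simp; ring
  map_mul' x y := by
    simp only [QuadraticAlgebra.re_mul, QuadraticAlgebra.im_mul]
    have h3 : (3 : ZMod 3) = 0 := rfl
    push_cast
    linear_combination -(x.im * y.im : ZMod 3) * h3

theorem residue_apply (z : Eisenstein) : residue z = ((z.re + z.im : ℤ) : ZMod 3) := rfl

-- Both `ω` and its conjugate are 1 modulo `θ`. Hence a Hermitian form becomes a symmetric bilinear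
-- form over the field with three elements.
@[simp] theorem residue_star (z : Eisenstein) : residue (star z) = residue z := by
  have h3 : (3 : ZMod 3) = 0 := rfl
  simp only [residue_apply, QuadraticAlgebra.re_star, QuadraticAlgebra.im_star]
  push_cast
  linear_combination -(z.im : ZMod 3) * h3

theorem θ_dvd_iff {z : Eisenstein} : θ ∣ z ↔ residue z = 0 := by
  rw [residue_apply, ZMod.intCast_zmod_eq_zero_iff_dvd]
  constructor
  · rintro ⟨w, rfl⟩
    simp only [θ_eq, QuadraticAlgebra.re_mul, QuadraticAlgebra.im_mul]
    exact ⟨w.re - w.im, by push_cast; ring⟩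
  · rintro ⟨k, hk⟩
    push_cast at hk
    refine ⟨⟨z.im - k, z.im - 2 * k⟩, ?_⟩
    apply QuadraticAlgebra.ext
    · simp [θ_eq]; linarith
    · simp [θ_eq]; ring

@[simp] theorem residue_θ : residue θ = 0 := θ_dvd_iff.1 dvd_rfl

theorem θ_dvd_intCast {n : ℤ} : θ ∣ (n : Eisenstein) ↔ 3 ∣ n := by
  rw [θ_dvd_iff, map_intCast, ZMod.intCast_zmod_eq_zero_iff_dvd]; rfl

theorem add_star_eq (z : Eisenstein) : z + star z = ((2 * z.re - z.im : ℤ) : Eisenstein) := by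
  apply QuadraticAlgebra.ext
  · rw [QuadraticAlgebra.re_intCast]; simp; ring
  · rw [QuadraticAlgebra.im_intCast]; simp

theorem eq_intCast_of_star_eq {z : Eisenstein} (h : star z = z) : z = (z.re : Eisenstein) := by
  have := congrArg QuadraticAlgebra.im h
  simp at this
  apply QuadraticAlgebra.ext
  · simp
  · simp; omega

/-- Adding a multiple of a null vector to a vector changes its norm by a trace; this formula shows
that traces from `θE` give every multiple of 3. -/
theorem θ_mul_add_star (z : Eisenstein) : θ * z + star (θ * z) = ((-3 * z.im : ℤ) : Eisenstein) := by
  rw [add_star_eq]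
  congr 1
  simp [θ_eq]; ring

/-! ### Isotropy of indefinite ternary forms -/

theorem exists_norm_modEq (p : ℕ) [Fact p.Prime] (hp : p ≠ 3) (b : ℤ) :
    ∃ z : Eisenstein, (p : ℤ) ∣ z.norm - b := by
  rcases (Fact.out : p.Prime).eq_two_or_odd with h2 | hodd
  · subst h2
    rcases Int.even_or_odd b with hb | hb
    · exact ⟨0, by simpa using hb.two_dvd⟩
    · refine ⟨1, ?_⟩
      obtain ⟨k, rfl⟩ := hb
      exact ⟨-k, by simp⟩
  · have h3 : (3 : ZMod p) ≠ 0 := by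
      intro h
      have : ((3 : ℕ) : ZMod p) = 0 := by exact_mod_cast h
      rw [ZMod.natCast_eq_zero_iff] at this
      exact hp ((Nat.prime_dvd_prime_iff_eq Fact.out Nat.prime_three).1 this)
    have h2 : (2 : ZMod p) ≠ 0 := by
      intro h
      have : ((2 : ℕ) : ZMod p) = 0 := by exact_mod_cast h
      rw [ZMod.natCast_eq_zero_iff] at this
      have := (Nat.prime_dvd_prime_iff_eq Fact.out Nat.prime_two).1 this
      omega
    -- With `u = 2 re - im` and `v = im`, four times the norm is `u² + 3v²`, so the equation to
    -- solve is `u² + 3v² = 4b`.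
    obtain ⟨u, v, huv⟩ := FiniteField.exists_root_sum_quadratic (R := ZMod p)
      (f := Polynomial.X ^ 2) (g := Polynomial.C 3 * Polynomial.X ^ 2 + Polynomial.C (-4 * (b : ZMod p)))
      (by simp) (by
        rw [Polynomial.degree_add_C]
        · rw [Polynomial.degree_C_mul h3]; simp
        · rw [Polynomial.degree_C_mul h3]; simp) (by rw [ZMod.card]; exact hodd)
    simp at huv
    refine ⟨⟨((u + v) / 2 : ZMod p).valMinAbs, v.valMinAbs⟩, ?_⟩
    rw [← ZMod.intCast_zmod_eq_zero_iff_dvd, norm_eq]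
    push_cast
    field_simp
    linear_combination huv

theorem exists_norm_sub_eq_mul (p : ℕ) [hp : Fact p.Prime] (hp3 : p ≠ 3) {b : ℤ} (hb : |b| ≤ p) :
    ∃ (x : Eisenstein) (c : ℤ), x.norm - b = p * c ∧ |c| < p := by
  have hbound : ∀ (x : Eisenstein) (c : ℤ), x.norm - b = p * c → (p : ℤ) * |c| ≤ x.norm + |b| := by
    intro x c hc
    have : (p : ℤ) * |c| = |x.norm - b| := by rw [hc, abs_mul, Nat.abs_cast]
    rw [this]
    exact (abs_sub _ _).trans (by rw [abs_of_nonneg (norm_nonneg x)])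
  by_cases hp2 : p = 2
  · subst hp2
    push_cast at hb hbound ⊢
    rcases Int.even_or_odd b with ⟨k, rfl⟩ | ⟨k, rfl⟩
    · have hx : (0 : Eisenstein).norm - (k + k) = 2 * -k := by simp; ring
      refine ⟨0, -k, hx, ?_⟩
      have := hbound _ _ hx
      simp at this ⊢
      omega
    · have hx : (1 : Eisenstein).norm - (2 * k + 1) = 2 * -k := by simp
      refine ⟨1, -k, hx, ?_⟩
      have := hbound _ _ hx
      simp at this ⊢
      omega
  obtain ⟨x₀, hx₀⟩ := exists_norm_modEq p hp3 b
  obtain ⟨x, k, hxk, hr1, hr2⟩ := exists_reduced p hp.out.pos x₀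
  have hx : (p : ℤ) ∣ x.norm - b := by
    have : x₀.norm = x.norm + p * ((x * star k).re * 2 - (x * star k).im + p * k.norm) := by
      rw [hxk]
      simp only [norm_eq, QuadraticAlgebra.re_mul, QuadraticAlgebra.im_mul,
        QuadraticAlgebra.re_add, QuadraticAlgebra.im_add, QuadraticAlgebra.re_star,
        QuadraticAlgebra.im_star, QuadraticAlgebra.re_natCast, QuadraticAlgebra.im_natCast]
      ring
    rw [this, add_sub_right_comm] at hx₀
    exact (dvd_add_left (dvd_mul_right _ _)).1 hx₀
  obtain ⟨c, hc⟩ := hx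
  refine ⟨x, c, hc, ?_⟩
  have h4 := four_mul_norm_le hr1 hr2
  have hxb := hbound x c hc
  -- The bound is `p|c| ≤ 3p²/4 + p`, which is below `p²` exactly when `p > 4`; this is why 2 was
  -- treated apart.
  have : 5 ≤ p := by
    have : p ≠ 4 := by rintro rfl; exact absurd hp.out (by norm_num)
    have := hp.out.two_le
    omega
  have : (5 : ℤ) ≤ p := by exact_mod_cast this
  nlinarith

/-- The Hermitian form `⟨1, -a, -b⟩` is isotropic. -/
def IsotropicTernary (a b : ℤ) : Prop :=
  ∃ x y z : Eisenstein, (x ≠ 0 ∨ y ≠ 0 ∨ z ≠ 0) ∧ x.norm = a * y.norm + b * z.norm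

theorem IsotropicTernary.symm {a b : ℤ} (h : IsotropicTernary a b) : IsotropicTernary b a := by
  obtain ⟨x, y, z, h0, h⟩ := h
  exact ⟨x, z, y, by tauto, by linarith⟩

theorem IsotropicTernary.exists_ne_zero {a b : ℤ} (h : IsotropicTernary a b) (hb : b ≠ 0) :
    ∃ x y z : Eisenstein, y ≠ 0 ∧ x.norm = a * y.norm + b * z.norm := by
  obtain ⟨x, y, z, h0, h⟩ := h
  by_cases hy : y = 0
  · subst hy
    have hx : x ≠ 0 := by
      rintro rfl
      simp [hb, norm_eq_zero] at h h0
      exact h0 h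
    -- Here `⟨1, -b⟩` is itself isotropic and represents everything: the witness is `(a + 1)² - (a -
    -- 1)² = 4a`, scaled by `N(x) = b N(z)`.
    refine ⟨((a + 1 : ℤ) : Eisenstein) * x, 2 * x, ((a - 1 : ℤ) : Eisenstein) * z, ?_, ?_⟩
    · exact mul_ne_zero two_ne_zero hx
    · have h2 : (2 : Eisenstein).norm = 4 := rfl
      simp only [map_mul, QuadraticAlgebra.norm_intCast, h2, Int.cast_id]
      simp at h
      linear_combination (a - 1) ^ 2 * h
  · exact ⟨x, y, z, hy, h⟩

/-- This is multiplicativity of the reduced norm of the quaternions `x + zj` with `j² = b`. It makes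
the values of `⟨1, -b⟩` closed under products. -/
theorem norm_sub_mul_norm_mul (b : ℤ) (x z x' z' : Eisenstein) :
    (x.norm - b * z.norm) * (x'.norm - b * z'.norm) =
      (x * x' + b * (star z' * z)).norm - b * (z' * x + z * star x').norm := by
  simp only [norm_eq, QuadraticAlgebra.re_mul, QuadraticAlgebra.im_mul, QuadraticAlgebra.re_add,
    QuadraticAlgebra.im_add, QuadraticAlgebra.re_star, QuadraticAlgebra.im_star,
    QuadraticAlgebra.re_intCast, QuadraticAlgebra.im_intCast, Int.cast_id]
  ring

theorem IsotropicTernary.mul {a a' b : ℤ} (hb : b ≠ 0) (h : IsotropicTernary a b)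
    (h' : IsotropicTernary a' b) : IsotropicTernary (a * a') b := by
  obtain ⟨x, y, z, hy, h⟩ := h.exists_ne_zero hb
  obtain ⟨x', y', z', hy', h'⟩ := h'.exists_ne_zero hb
  refine ⟨x * x' + b * (star z' * z), y * y', z' * x + z * star x',
    Or.inr (Or.inl (mul_ne_zero hy hy')), ?_⟩
  have key := norm_sub_mul_norm_mul b x z x' z'
  rw [h, h'] at key
  rw [map_mul]
  linear_combination -key

theorem IsotropicTernary.of_mul_norm {a b : ℤ} {c : Eisenstein} (hc : c ≠ 0) (hb : b ≠ 0)
    (h : IsotropicTernary (a * c.norm) b) : IsotropicTernary a b := by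
  obtain ⟨x, y, z, hy, h⟩ := h.exists_ne_zero hb
  exact ⟨x, c * y, z, Or.inr (Or.inl (mul_ne_zero hc hy)), by rw [map_mul]; linarith⟩

theorem isotropicTernary_of_norm (c : Eisenstein) (b : ℤ) : IsotropicTernary c.norm b :=
  ⟨c, 1, 0, Or.inr (Or.inl one_ne_zero), by simp⟩

/-- The descent step: `⟨1, -a, -b⟩` is isotropic if `a k = N(x) - b` and `⟨1, -k, -b⟩` is. -/
theorem IsotropicTernary.of_mul_eq {a b k : ℤ} {x : Eisenstein} (hb : b ≠ 0) (hk : k ≠ 0)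
    (hx : a * k = x.norm - b) (h : IsotropicTernary k b) : IsotropicTernary a b := by
  have h1 : IsotropicTernary (a * k) b :=
    ⟨x, 1, 1, Or.inr (Or.inl one_ne_zero), by rw [hx]; simp⟩
  -- The form `⟨1, -ak², -b⟩` is isotropic, and the square `k² = N(k)` can be absorbed into `y`.
  have h2 := h1.mul hb h
  have hN : (k : Eisenstein).norm = k ^ 2 := QuadraticAlgebra.norm_intCast k
  refine IsotropicTernary.of_mul_norm (c := (k : Eisenstein)) (by exact_mod_cast hk) hb ?_
  rw [hN, pow_two, ← mul_assoc]
  exact h2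

/-- Descent on `|a| + |b|` with `|b| ≤ |a|`. A composite `a` is factored, by multiplicativity in
`a`. If `a = ±p` with `p ≠ 3`, a small solution of `N(x) ≡ b` modulo `p` replaces `a` by a cofactor
of absolute value less than `p`. The prime 3 is the norm of `θ`. -/
theorem isotropicTernary_aux (N : ℕ) : ∀ a b : ℤ, a.natAbs + b.natAbs ≤ N → a ≠ 0 → b ≠ 0 →
    (0 < a ∨ 0 < b) → IsotropicTernary a b := by
  induction N with
  | zero => intro a b h ha; omega
  | succ N ih =>
    have main : ∀ a b : ℤ, a.natAbs + b.natAbs ≤ N + 1 → a ≠ 0 → b ≠ 0 →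
        (0 < a ∨ 0 < b) → b.natAbs ≤ a.natAbs → IsotropicTernary a b := by
      intro a b hN ha hb hab hle
      by_cases h1 : a.natAbs = 1
      · rcases hab with h | h
        · have : a = (1 : Eisenstein).norm := by simp; omega
          rw [this]; exact isotropicTernary_of_norm _ _
        · have : b = (1 : Eisenstein).norm := by simp; omega
          rw [this]; exact (isotropicTernary_of_norm _ _).symm
      obtain ⟨p, hp, hpa⟩ := Nat.exists_prime_and_dvd h1
      have : Fact p.Prime := ⟨hp⟩
      have hp2 := hp.two_le
      obtain ⟨a', rfl⟩ := Int.natCast_dvd.2 hpa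
      rw [Int.natAbs_mul, Int.natAbs_natCast] at *
      have ha' : a' ≠ 0 := by rintro rfl; simp at ha
      have hpos : 1 ≤ a'.natAbs := by omega
      have hsign : 0 < a' ∨ 0 < b := by
        rcases hab with h | h
        · left; exact (mul_pos_iff_of_pos_left (by exact_mod_cast hp.pos)).1 h
        · exact Or.inr h
      have hlt : a'.natAbs < p * a'.natAbs := by nlinarith
      by_cases hp3 : p = 3
      · have h3 : ((p : ℕ) : ℤ) = θ.norm := by rw [hp3, θ_eq, norm_eq]; norm_num
        refine IsotropicTernary.mul hb ?_ (ih a' b (by omega) ha' hb hsign)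
        rw [h3]; exact isotropicTernary_of_norm _ _
      by_cases ha1 : a'.natAbs = 1
      · have hb1 : |b| ≤ p := by
          rw [ha1] at hle; rw [Int.abs_eq_natAbs]; omega
        obtain ⟨x, c, hc, hbound⟩ := exists_norm_sub_eq_mul p hp3 hb1
        have haa : a' * a' = 1 := by
          rcases Int.natAbs_eq a' with h | h <;> rw [h, ha1] <;> norm_num
        have hk : p * a' * (a' * c) = x.norm - b := by rw [hc]; linear_combination p * c * haa
        by_cases hc0 : c = 0
        · rw [hc0, mul_zero] at hc
          have : b = x.norm := by linarith
          rw [this]; exact (isotropicTernary_of_norm _ _).symm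
        refine IsotropicTernary.of_mul_eq hb (mul_ne_zero ha' hc0) hk (ih _ b ?_ (mul_ne_zero ha' hc0) hb ?_)
        · rw [Int.natAbs_mul, ha1]
          rw [Int.abs_eq_natAbs] at hbound
          rw [ha1] at hN
          omega
        -- The sign condition survives: if `b < 0` then `a > 0`, and `ak = N(x) - b > 0` forces the
        -- cofactor `k` to be positive.
        · by_contra hcon
          push Not at hcon
          have hapos : 0 < a' := by
            rcases hsign with h | h
            · exact h
            · omega
          have : 0 < (p : ℤ) * a' * (a' * c) := by rw [hk]; have := norm_nonneg x; omega
          have hp0 : 0 < (p : ℤ) * a' := mul_pos (by positivity) hapos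
          exact absurd hcon.1 (not_le.2 ((mul_pos_iff_of_pos_left hp0).1 this))
      · have h2a : 2 ≤ a'.natAbs := by omega
        refine IsotropicTernary.mul hb (ih p b ?_ (by positivity) hb (Or.inl (by positivity)))
          (ih a' b (by omega) ha' hb hsign)
        rw [Int.natAbs_natCast]
        nlinarith
    intro a b hN ha hb hab
    rcases le_total b.natAbs a.natAbs with h | h
    · exact main a b hN ha hb hab h
    · exact (main b a (by omega) hb ha hab.symm h).symm

/-- Indefinite ternary diagonal Hermitian forms over the Eisenstein integers are isotropic. -/
theorem exists_isotropic_ternary {a b c : ℤ} (ha : 0 < a) (hb : b < 0) (hc : c ≠ 0) :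
    ∃ x y z : Eisenstein, (x ≠ 0 ∨ y ≠ 0 ∨ z ≠ 0) ∧ a * x.norm + b * y.norm + c * z.norm = 0 := by
  -- Multiplying the form by `a` and absorbing `a² = N(a)` turns it into `⟨1, ab, ac⟩`, where `-ab >
  -- 0`.
  obtain ⟨x, y, z, h0, h⟩ := isotropicTernary_aux _ (-(a * b)) (-(a * c)) le_rfl
    (by simp; omega) (by simp; omega) (Or.inl (by nlinarith))
  have hN : (a : Eisenstein).norm = a ^ 2 := QuadraticAlgebra.norm_intCast a
  have ha' : (a : Eisenstein) ≠ 0 := by exact_mod_cast ha.ne'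
  refine ⟨x, a * y, a * z, ?_, ?_⟩
  · simpa [ha', ha.ne'] using h0
  · rw [map_mul, map_mul, hN]
    linear_combination a * h

end Eisenstein

end

/-! ### Functionals, modular forms and isometries -/

noncomputable section

namespace Eisenstein

theorem exists_functional_div {M : Type*} [AddCommGroup M] [Module Eisenstein M]
    {c : Eisenstein} (hc : c ≠ 0) (f : M →ₗ[Eisenstein] Eisenstein) (hf : ∀ x, c ∣ f x) :
    ∃ g : M →ₗ[Eisenstein] Eisenstein, ∀ x, f x = c * g x := by
  choose g hg using hf
  refine ⟨{ toFun := g, map_add' := fun x y => ?_, map_smul' := fun r x => ?_ }, hg⟩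
  · apply mul_left_cancel₀ hc
    rw [← hg, map_add, hg, hg, mul_add]
  · apply mul_left_cancel₀ hc
    rw [← hg, map_smul, hg, smul_eq_mul, smul_eq_mul, RingHom.id_apply]
    ring

/-- The values at `x` of all functionals form an ideal. A generator `d` divides every coordinate of
`x` and is itself attained, so the quotient `ρ` takes the value 1 under that functional. -/
theorem exists_eq_smul_functional_eq_one {M : Type*} [AddCommGroup M] [Module Eisenstein M]
    [Module.Free Eisenstein M] [Module.Finite Eisenstein M] {x : M} (hx : x ≠ 0) :
    ∃ (d : Eisenstein) (ρ : M) (f : M →ₗ[Eisenstein] Eisenstein), d ≠ 0 ∧ x = d • ρ ∧ f ρ = 1 := by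
  let b := Module.Free.chooseBasis Eisenstein M
  let I : Ideal Eisenstein := LinearMap.range (Module.Dual.eval Eisenstein M x)
  obtain ⟨d, hd⟩ := IsPrincipalIdealRing.principal I
  have hdvd : ∀ f : M →ₗ[Eisenstein] Eisenstein, d ∣ f x := fun f => by
    have : f x ∈ I := ⟨f, rfl⟩
    rw [hd] at this
    exact Ideal.mem_span_singleton.1 this
  have hmem : d ∈ I := by rw [hd]; exact Submodule.mem_span_singleton_self d
  obtain ⟨f, hf⟩ := hmem
  have hf : f x = d := hf
  choose k hk using fun i => hdvd (b.coord i)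
  have hxd : x = d • ∑ i, k i • b i := by
    conv_lhs => rw [← b.sum_repr x]
    rw [Finset.smul_sum]
    refine Finset.sum_congr rfl fun i _ => ?_
    rw [smul_smul, ← hk i]
    rfl
  have hd0 : d ≠ 0 := by
    rintro rfl
    exact hx (by rw [hxd, zero_smul])
  refine ⟨d, _, f, hd0, hxd, ?_⟩
  apply mul_left_cancel₀ hd0
  rw [mul_one, ← smul_eq_mul, ← map_smul, ← hxd, hf]

end Eisenstein

namespace HermForm

open Eisenstein

variable {L : Type*} [AddCommGroup L] [Module Eisenstein L]
variable {M : Type*} [AddCommGroup M] [Module Eisenstein M]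
variable {N : Type*} [AddCommGroup N] [Module Eisenstein N]

section basic

variable (h : HermForm L)

theorem form_add_left (x y z : L) : h.form (x + y) z = h.form x z + h.form y z := by simp

theorem form_sub_left (x y z : L) : h.form (x - y) z = h.form x z - h.form y z := by simp

theorem form_smul_left (a : Eisenstein) (x y : L) : h.form (a • x) y = a * h.form x y := by simp

theorem form_add_right (x y z : L) : h.form x (y + z) = h.form x y + h.form x z := by simp

theorem form_sub_right (x y z : L) : h.form x (y - z) = h.form x y - h.form x z := by simp

theorem form_smul_right (a : Eisenstein) (x y : L) :
    h.form x (a • y) = star a * h.form x y := by simp [starRingEnd_apply]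

/-- The norm `⟨x, x⟩` of a vector, as an integer. -/
def normSq (x : L) : ℤ := (h.form x x).re

theorem form_self (x : L) : h.form x x = (h.normSq x : Eisenstein) :=
  eq_intCast_of_star_eq (h.star_form x x)

theorem normSq_eq_iff {x : L} {n : ℤ} : h.normSq x = n ↔ h.form x x = (n : Eisenstein) := by
  rw [form_self, Int.cast_inj]

theorem normSq_smul (a : Eisenstein) (x : L) : h.normSq (a • x) = a.norm * h.normSq x := by
  rw [normSq_eq_iff, form_smul_left, form_smul_right, form_self]
  push_cast
  rw [← mul_star_eq]
  ring

theorem normSq_add (x y : L) :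
    h.normSq (x + y) = h.normSq x + h.normSq y + (2 * (h.form x y).re - (h.form x y).im) := by
  rw [normSq_eq_iff]
  push_cast
  have := add_star_eq (h.form x y)
  push_cast at this
  rw [← this, h.star_form, ← form_self, ← form_self]
  simp
  ring

/-- A Hermitian form from a function that is linear in its first argument. -/
def ofFun (f : L → L → Eisenstein) (hadd : ∀ x y z, f (x + y) z = f x z + f y z)
    (hsmul : ∀ a x y, f (a • x) y = a * f x y) (hstar : ∀ x y, star (f x y) = f y x) :
    HermForm L where
  form := LinearMap.mk₂'ₛₗ (RingHom.id Eisenstein) (starRingEnd Eisenstein) f hadd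
    (fun a x y => by rw [hsmul]; rfl)
    (fun x y z => by rw [← hstar, hadd, star_add, hstar, hstar])
    (fun a x y => by rw [← hstar, hsmul, star_mul', hstar]; rfl)
  star_form := fun x y => hstar x y

@[simp] theorem ofFun_form (f : L → L → Eisenstein) (hadd hsmul hstar) (x y : L) :
    (ofFun f hadd hsmul hstar).form x y = f x y := rfl

/-- The form restricted to a submodule. -/
def restrict (K : Submodule Eisenstein L) : HermForm K :=
  ofFun (fun x y => h.form x y) (by simp) (by simp) (fun x y => h.star_form x y)

@[simp] theorem restrict_form (K : Submodule Eisenstein L) (x y : K) :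
    (h.restrict K).form x y = h.form x y := rfl

theorem exists_div {n : ℤ} (hn : n ≠ 0) (hdiv : ∀ x y, (n : Eisenstein) ∣ h.form x y) :
    ∃ g : HermForm L, ∀ x y, h.form x y = n * g.form x y := by
  have hn' : (n : Eisenstein) ≠ 0 := by exact_mod_cast hn
  choose g hg using hdiv
  refine ⟨ofFun g (fun x y z => ?_) (fun a x y => ?_) (fun x y => ?_), hg⟩ <;>
    apply mul_left_cancel₀ hn'
  · rw [← hg, form_add_left, hg, hg, mul_add]
  · rw [← hg, form_smul_left, hg]; ring
  · rw [← hg, ← h.star_form, hg, star_mul', star_intCast]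

/-- The form has values in `c E`, and all linear functionals on the lattice are
of the form `⟨·, y⟩ / c`. -/
structure IsModular (c : Eisenstein) : Prop where
  dvd : ∀ x y, c ∣ h.form x y
  exists_form_eq : ∀ f : L →ₗ[Eisenstein] Eisenstein, ∃ y, ∀ x, h.form x y = c * f x

variable {h}

theorem IsModular.eq_zero [Module.Free Eisenstein L] {c : Eisenstein} (hh : h.IsModular c)
    {v : L} (hv : ∀ x, h.form x v = 0) (hc : c ≠ 0) : v = 0 := by
  by_contra hne
  obtain ⟨f, hf⟩ : ∃ f : L →ₗ[Eisenstein] Eisenstein, f v ≠ 0 := by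
    by_contra! hcon
    exact hne ((Module.forall_dual_apply_eq_zero_iff Eisenstein v).1 hcon)
  obtain ⟨y, hy⟩ := hh.exists_form_eq f
  apply mul_ne_zero hc hf
  rw [← hy, ← h.star_form, hv, star_zero]

end basic

section isometry

/-- An isometry from a bijective linear map preserving the forms. -/
def Isometry.ofBijective {h : HermForm L} {k : HermForm M} (f : L →ₗ[Eisenstein] M)
    (hf : Function.Bijective f) (hform : ∀ x y, k.form (f x) (f y) = h.form x y) :
    Isometry h k where
  toLinearEquiv := LinearEquiv.ofBijective f hf
  map_form' := hform

theorem Isometry.map_form {h : HermForm L} {k : HermForm M} (e : Isometry h k) (x y : L) :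
    k.form (e.toLinearEquiv x) (e.toLinearEquiv y) = h.form x y := e.map_form' x y

/-- The inverse isometry. -/
def Isometry.symm {h : HermForm L} {k : HermForm M} (e : Isometry h k) : Isometry k h where
  toLinearEquiv := e.toLinearEquiv.symm
  map_form' := fun x y => by
    rw [← e.map_form']
    exact congrArg₂ (fun a b => k.form a b) (e.toLinearEquiv.apply_symm_apply x)
      (e.toLinearEquiv.apply_symm_apply y)

/-- The composition of two isometries. -/
def Isometry.trans {h : HermForm L} {k : HermForm M} {g : HermForm N} (e : Isometry h k)
    (f : Isometry k g) : Isometry h g where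
  toLinearEquiv := e.toLinearEquiv.trans f.toLinearEquiv
  map_form' := fun x y => (f.map_form' _ _).trans (e.map_form' x y)

theorem Isometry.isModular {h : HermForm L} {k : HermForm M} (e : Isometry h k) {c : Eisenstein}
    (hh : h.IsModular c) : k.IsModular c where
  dvd x y := by rw [← e.symm.map_form]; exact hh.dvd _ _
  exists_form_eq f := by
    obtain ⟨y, hy⟩ := hh.exists_form_eq (f ∘ₗ e.toLinearEquiv.toLinearMap)
    refine ⟨e.toLinearEquiv y, fun x => ?_⟩
    have h1 := hy (e.toLinearEquiv.symm x)
    rw [← e.map_form] at h1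
    simpa using h1

end isometry

section hyp

/-- The orthogonal sum of a hyperbolic plane, spanned by two null vectors with inner product `θ`,
and the given lattice. -/
def hyp (k : HermForm L) : HermForm (Eisenstein × Eisenstein × L) :=
  ofFun (fun v w => θ * (v.1 * star w.2.1 - v.2.1 * star w.1) + k.form v.2.2 w.2.2)
    (fun x y z => by simp; ring) (fun a x y => by simp; ring)
    (fun x y => by simp [star_θ, k.star_form]; ring)

end hyp

end HermForm

end

/-! ### Splitting off a hyperbolic plane -/

noncomputable section

namespace HermForm

open Eisenstein

variable {L : Type*} [AddCommGroup L] [Module Eisenstein L]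
variable {M : Type*} [AddCommGroup M] [Module Eisenstein M]

theorem hyp_form (k : HermForm L) (v w : Eisenstein × Eisenstein × L) :
    k.hyp.form v w = θ * (v.1 * star w.2.1 - v.2.1 * star w.1) + k.form v.2.2 w.2.2 := rfl

theorem hyp_form_one_left (k : HermForm L) (v : Eisenstein × Eisenstein × L) :
    k.hyp.form v (1, 0, 0) = -θ * v.2.1 := by
  simp [hyp_form]

theorem isModular_hyp_iff {k : HermForm L} : k.hyp.IsModular θ ↔ k.IsModular θ := by
  constructor
  · intro hk
    refine ⟨fun x y => ?_, fun f => ?_⟩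
    · simpa [hyp_form] using hk.dvd (0, 0, x) (0, 0, y)
    · obtain ⟨y, hy⟩ := hk.exists_form_eq
        (f ∘ₗ LinearMap.snd Eisenstein Eisenstein L ∘ₗ LinearMap.snd Eisenstein Eisenstein _)
      exact ⟨y.2.2, fun x => by simpa [hyp_form] using hy (0, 0, x)⟩
  · intro hk
    refine ⟨fun x y => ?_, fun f => ?_⟩
    · rw [hyp_form]
      exact dvd_add (dvd_mul_right _ _) (hk.dvd _ _)
    · obtain ⟨z, hz⟩ := hk.exists_form_eq
        (f ∘ₗ LinearMap.inr Eisenstein Eisenstein _ ∘ₗ LinearMap.inr Eisenstein Eisenstein L)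
      refine ⟨(-star (f (0, 1, 0)), star (f (1, 0, 0)), z), fun x => ?_⟩
      rw [hyp_form]
      simp only [hz, star_neg, star_star, LinearMap.comp_apply, LinearMap.inr_apply]
      have hx : x = x.1 • (1, 0, 0) + x.2.1 • (0, 1, 0) + (0, 0, x.2.2) := by
        ext <;> simp
      conv_rhs => rw [hx, map_add, map_add, map_smul, map_smul, smul_eq_mul, smul_eq_mul]
      ring

/-- If a lattice is the sum of a hyperbolic plane and `k`, then `k` is recovered as `ρ^⊥/⟨ρ⟩`. -/
theorem Isometry.nonempty_quotForm {k : HermForm L} {h : HermForm M} (e : Isometry k.hyp h) :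
    Nonempty (Isometry (h.quotForm (e.toLinearEquiv (1, 0, 0))) k) := by
  set ρ := e.toLinearEquiv (1, 0, 0) with hρ
  have key : ∀ x : M, h.form x ρ = -θ * (e.toLinearEquiv.symm x).2.1 := fun x => by
    rw [← hyp_form_one_left, ← e.map_form, LinearEquiv.apply_symm_apply]
  have hperp : ∀ x : h.perp ρ, (e.toLinearEquiv.symm x).2.1 = 0 := fun x => by
    have h1 : h.form x ρ = 0 := x.2
    rw [key] at h1
    exact (mul_eq_zero.1 h1).resolve_left (neg_ne_zero.2 θ_ne_zero)
  let g : h.perp ρ →ₗ[Eisenstein] L := LinearMap.snd Eisenstein Eisenstein L ∘ₗ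
    LinearMap.snd Eisenstein Eisenstein _ ∘ₗ e.toLinearEquiv.symm.toLinearMap ∘ₗ (h.perp ρ).subtype
  have hg : ∀ x : h.perp ρ, g x = (e.toLinearEquiv.symm x).2.2 := fun x => rfl
  have hker : ∀ x : h.perp ρ, x ∈ h.spanInPerp ρ ↔ g x = 0 := by
    intro x
    rw [hg]
    constructor
    · intro hx
      obtain ⟨c, hc⟩ := Submodule.mem_span_singleton.1
        (show (x : M) ∈ Submodule.span Eisenstein {ρ} from hx)
      rw [← hc, map_smul, hρ, LinearEquiv.symm_apply_apply]
      simp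
    · intro hx
      refine Submodule.mem_span_singleton.2 ⟨(e.toLinearEquiv.symm x).1, ?_⟩
      have h1 : (e.toLinearEquiv.symm x).1 • ((1, 0, 0) : Eisenstein × Eisenstein × L) =
          e.toLinearEquiv.symm x := by
        refine Prod.ext ?_ (Prod.ext ?_ ?_)
        · simp
        · simp [hperp]
        · simp [hx]
      have h2 := congrArg e.toLinearEquiv h1
      rwa [map_smul, LinearEquiv.apply_symm_apply] at h2
  have hle : h.spanInPerp ρ ≤ LinearMap.ker g := fun x hx => (hker x).1 hx
  refine ⟨Isometry.ofBijective ((h.spanInPerp ρ).liftQ g hle) ⟨?_, ?_⟩ ?_⟩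
  · rw [← LinearMap.ker_eq_bot, Submodule.ker_liftQ_eq_bot]
    exact fun x hx => (hker x).2 hx
  · intro z
    refine ⟨Submodule.Quotient.mk ⟨e.toLinearEquiv (0, 0, z), ?_⟩, ?_⟩
    · change h.form _ _ = 0
      rw [key, LinearEquiv.symm_apply_apply]
      simp
    · rw [Submodule.liftQ_apply, hg]
      simp
  · intro x y
    obtain ⟨x, rfl⟩ := Submodule.mkQ_surjective _ x
    obtain ⟨y, rfl⟩ := Submodule.mkQ_surjective _ y
    change k.form (e.toLinearEquiv.symm x).2.2 (e.toLinearEquiv.symm y).2.2 = h.form x y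
    rw [← e.symm.map_form]
    change _ = k.hyp.form (e.toLinearEquiv.symm x) (e.toLinearEquiv.symm y)
    rw [hyp_form, hperp, hperp]
    simp

theorem Isometry.isPrimitiveNull {k : HermForm L} {h : HermForm M} (e : Isometry k.hyp h) :
    h.IsPrimitiveNull (e.toLinearEquiv (1, 0, 0)) where
  null := by rw [e.map_form, hyp_form_one_left]; simp
  primitive a x hx := by
    have h1 := congrArg (fun v => (e.toLinearEquiv.symm v).1) hx
    simp only [LinearEquiv.symm_apply_apply, map_smul, Prod.smul_fst, smul_eq_mul] at h1
    exact IsUnit.of_mul_eq_one _ h1.symm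

variable [Module.Free Eisenstein M] [Module.Finite Eisenstein M]

theorem IsModular.exists_form_eq_of_isPrimitiveNull {h : HermForm M} (hh : h.IsModular θ) {ρ : M}
    (hρ : h.IsPrimitiveNull ρ) : ∃ y, h.form ρ y = θ ∧ h.form y y = 0 := by
  have hρ0 : ρ ≠ 0 := by
    rintro rfl
    exact not_isUnit_zero (hρ.primitive 0 0 (by simp))
  obtain ⟨d, x, f, hd, hx, hf⟩ := exists_eq_smul_functional_eq_one hρ0
  obtain ⟨u, hu⟩ := (hρ.primitive d x hx).exists_left_inv
  obtain ⟨y, hy⟩ := hh.exists_form_eq (u • f)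
  have h1 : h.form ρ y = θ := by
    rw [hy, LinearMap.smul_apply, hx, map_smul, hf, smul_eq_mul, smul_eq_mul, mul_one, hu, mul_one]
  obtain ⟨m, hm⟩ : (3 : ℤ) ∣ h.normSq y := by
    rw [← θ_dvd_intCast, ← form_self]
    exact hh.dvd y y
  have hyy : h.form y y = 3 * (m : Eisenstein) := by rw [form_self, hm]; push_cast; rfl
  have h2 : h.form y ρ = -θ := by rw [← h.star_form, h1, star_θ]
  have h3 := θ_mul_add_star (m • Eisenstein.ω)
  -- The norm of `y` is `3m`, and adding `aρ` changes it by the trace of `θa`, which is `-3 im a`;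
  -- so `a = mω` makes it zero.
  refine ⟨y + (m • Eisenstein.ω) • ρ, ?_, ?_⟩
  · rw [form_add_right, form_smul_right, hρ.null, h1]; simp
  · simp only [form_add_right, form_smul_right, form_add_left, form_smul_left, hρ.null, h1, h2,
      hyy]
    have h4 : (m • Eisenstein.ω).im = m := by simp [Eisenstein.ω]
    rw [h4, star_mul', star_θ] at h3
    push_cast at h3 ⊢
    linear_combination h3

/-- A primitive null vector splits off a hyperbolic plane. -/
theorem IsModular.exists_isometry_hyp {h : HermForm M} (hh : h.IsModular θ) {ρ : M}
    (hρ : h.IsPrimitiveNull ρ) :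
    ∃ e : Isometry (h.quotForm ρ).hyp h, e.toLinearEquiv (1, 0, 0) = ρ := by
  obtain ⟨y, hy, hyy⟩ := hh.exists_form_eq_of_isPrimitiveNull hρ
  have hyρ : h.form y ρ = -θ := by rw [← h.star_form, hy, star_θ]
  have flip : ∀ z, ∃ f : M →ₗ[Eisenstein] Eisenstein, ∀ x, h.form x z = θ * f x := fun z =>
    exists_functional_div θ_ne_zero
      { toFun := fun x => h.form x z, map_add' := by simp, map_smul' := by simp }
      fun x => hh.dvd x z
  obtain ⟨A, hA⟩ := flip y
  obtain ⟨B, hB⟩ := flip ρ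
  have hAρ : A ρ = 1 := mul_left_cancel₀ θ_ne_zero (by rw [← hA, hy, mul_one])
  -- Subtracting `A x • ρ` projects `ρ^⊥` onto the vectors orthogonal to both `ρ` and `y`. It kills
  -- `ρ` since `A ρ = 1`, so it descends to the quotient and embeds it as the complement of the
  -- plane.
  let s : h.perp ρ →ₗ[Eisenstein] M :=
    (LinearMap.id - A.smulRight ρ) ∘ₗ (h.perp ρ).subtype
  have hs : ∀ x : h.perp ρ, s x = (x : M) - A x • ρ := fun x => rfl
  let t : h.Quot ρ →ₗ[Eisenstein] M := (h.spanInPerp ρ).liftQ s (by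
    intro x hx
    obtain ⟨c, hc⟩ := Submodule.mem_span_singleton.1
      (show (x : M) ∈ Submodule.span Eisenstein {ρ} from hx)
    change s x = 0
    rw [hs, ← hc, map_smul, hAρ]
    simp)
  have ht : ∀ x : h.perp ρ, t (Submodule.Quotient.mk x) = (x : M) - A x • ρ := fun x => rfl
  have hxρ : ∀ x : h.perp ρ, h.form (x : M) ρ = 0 := fun x => x.2
  have hρx : ∀ x : h.perp ρ, h.form ρ (x : M) = 0 := fun x => by rw [← h.star_form, hxρ, star_zero]
  have htρ : ∀ q, h.form (t q) ρ = 0 := by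
    rintro ⟨x⟩
    change h.form ((x : M) - A x • ρ) ρ = 0
    rw [form_sub_left, form_smul_left, hρ.null, hxρ]; simp
  have hty : ∀ q, h.form (t q) y = 0 := by
    rintro ⟨x⟩
    change h.form ((x : M) - A x • ρ) y = 0
    rw [form_sub_left, form_smul_left, hy, hA]; ring
  have hρt : ∀ q, h.form ρ (t q) = 0 := fun q => by rw [← h.star_form, htρ, star_zero]
  have hyt : ∀ q, h.form y (t q) = 0 := fun q => by rw [← h.star_form, hty, star_zero]
  have htt : ∀ q r, h.form (t q) (t r) = (h.quotForm ρ).form q r := by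
    rintro ⟨x⟩ ⟨z⟩
    change h.form ((x : M) - A x • ρ) ((z : M) - A z • ρ) = h.form x z
    simp only [form_sub_left, form_sub_right, form_smul_left, form_smul_right, hρ.null, hxρ, hρx]
    ring
  let F : Eisenstein × Eisenstein × h.Quot ρ →ₗ[Eisenstein] M :=
    LinearMap.coprod (LinearMap.toSpanSingleton Eisenstein M ρ)
      (LinearMap.coprod (LinearMap.toSpanSingleton Eisenstein M y) t)
  have hF : ∀ v, F v = v.1 • ρ + (v.2.1 • y + t v.2.2) := fun v => rfl
  refine ⟨Isometry.ofBijective F ⟨?_, ?_⟩ ?_, ?_⟩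
  · rw [← LinearMap.ker_eq_bot, LinearMap.ker_eq_bot']
    rintro ⟨a, b, q⟩ hv
    rw [hF] at hv
    simp only at hv
    have h1 := congrArg (fun w => h.form w y) hv
    have h2 := congrArg (fun w => h.form w ρ) hv
    simp only [form_add_left, form_smul_left, hρ.null, hyρ, hy, hyy, htρ, hty, map_zero,
      LinearMap.zero_apply, mul_zero, zero_add, add_zero, mul_eq_zero, neg_eq_zero, θ_ne_zero,
      or_false] at h1 h2
    subst h1 h2
    obtain ⟨x, rfl⟩ := Submodule.mkQ_surjective _ q
    simp only [zero_smul, zero_add] at hv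
    have hv : (x : M) - A x • ρ = 0 := hv
    have : x ∈ h.spanInPerp ρ :=
      Submodule.mem_span_singleton.2 ⟨A x, (sub_eq_zero.1 hv).symm⟩
    have hq : (Submodule.Quotient.mk x : h.Quot ρ) = 0 :=
      (Submodule.Quotient.mk_eq_zero _).2 this
    exact Prod.ext rfl (Prod.ext rfl hq)
  · intro w
    have hmem : w + B w • y ∈ h.perp ρ := by
      change h.form _ ρ = 0
      rw [form_add_left, form_smul_left, hyρ, hB]; ring
    refine ⟨(A (w + B w • y), -B w, Submodule.Quotient.mk ⟨_, hmem⟩), ?_⟩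
    rw [hF, ht]
    module
  · intro v w
    simp only [hF, hyp_form, form_add_left, form_add_right, form_smul_left, form_smul_right,
      hρ.null, hy, hyy, hyρ, htρ, hty, hρt, hyt, htt]
    ring
  · change F (1, 0, 0) = ρ
    rw [hF]; simp

end HermForm

end

/-! ### Extension to `ℂ` and the meaning of `L = θL'` -/

noncomputable section

namespace Eisenstein

theorem algebraMap_complex_injective : Function.Injective (algebraMap Eisenstein ℂ) := by
  rw [injective_iff_map_eq_zero]
  intro z hz
  by_contra hne
  have h1 : algebraMap Eisenstein ℂ (z * star z) = 0 := by rw [map_mul, hz, zero_mul]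
  rw [mul_star_eq, map_intCast] at h1
  exact (norm_pos hne).ne' (by exact_mod_cast h1)

theorem algebraMap_θ_ne_zero : algebraMap Eisenstein ℂ θ ≠ 0 := fun h =>
  θ_ne_zero (algebraMap_complex_injective (h.trans (map_zero _).symm))

theorem exists_tendsto_floor (u : ℝ) : ∃ a : ℕ → ℤ,
    Filter.Tendsto (fun T : ℕ => (T : ℝ)⁻¹ * a T) Filter.atTop (nhds u) := by
  refine ⟨fun T => ⌊T * u⌋, ?_⟩
  rw [Metric.tendsto_atTop]
  intro ε hε
  obtain ⟨n, hn⟩ := exists_nat_gt ε⁻¹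
  refine ⟨n, fun T hT => ?_⟩
  have hn0 : (0 : ℝ) < n := (inv_pos.2 hε).trans hn
  have hT' : (n : ℝ) ≤ T := by exact_mod_cast hT
  have hT0 : (0 : ℝ) < T := hn0.trans_le hT'
  have h1 := Int.floor_le (T * u)
  have h2 := Int.lt_floor_add_one (T * u)
  have h3 : (T : ℝ)⁻¹ * ⌊T * u⌋ - u = (T : ℝ)⁻¹ * (⌊T * u⌋ - T * u) := by field_simp
  rw [Real.dist_eq, h3, abs_mul, abs_of_pos (inv_pos.2 hT0)]
  have h4 : |(⌊T * u⌋ : ℝ) - T * u| ≤ 1 := by rw [abs_le]; constructor <;> linarith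
  calc (T : ℝ)⁻¹ * |(⌊T * u⌋ : ℝ) - T * u| ≤ (T : ℝ)⁻¹ * 1 := by gcongr
    _ = (T : ℝ)⁻¹ := mul_one _
    _ ≤ (n : ℝ)⁻¹ := by gcongr
    _ < ε := inv_lt_of_inv_lt₀ hε hn

/-- The fractions `a / T` with `a` an Eisenstein integer are dense in `ℂ`. -/
theorem exists_tendsto_complex (z : ℂ) : ∃ a : ℕ → Eisenstein,
    Filter.Tendsto (fun T : ℕ => (T : ℂ)⁻¹ * algebraMap Eisenstein ℂ (a T)) Filter.atTop (nhds z) := by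
  have h3 : Real.sqrt 3 ≠ 0 := by positivity
  obtain ⟨a, ha⟩ := exists_tendsto_floor (z.re + z.im / Real.sqrt 3)
  obtain ⟨b, hb⟩ := exists_tendsto_floor (2 * z.im / Real.sqrt 3)
  refine ⟨fun T => ⟨a T, b T⟩, ?_⟩
  have hz : z = ((z.re + z.im / Real.sqrt 3 : ℝ) : ℂ) + ((2 * z.im / Real.sqrt 3 : ℝ) : ℂ) * omegaC := by
    apply Complex.ext
    · simp [omegaC]; field_simp; ring
    · simp [omegaC]; field_simp
  have key := ((Complex.continuous_ofReal.tendsto _).comp ha).add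
    (((Complex.continuous_ofReal.tendsto _).comp hb).mul_const omegaC)
  rw [← hz] at key
  refine key.congr fun T => ?_
  rw [toComplex_apply]
  simp
  ring

end Eisenstein

namespace HermForm

open Eisenstein

variable {L : Type*} [AddCommGroup L] [Module Eisenstein L]
variable {M : Type*} [AddCommGroup M] [Module Eisenstein M]

theorem complexForm_star (h : HermForm L) (u v : ℂ ⊗[Eisenstein] L) :
    conj (h.complexForm u v) = h.complexForm v u := by
  induction u using TensorProduct.induction_on with
  | zero => simp
  | add u u' hu hu' => simp only [map_add, LinearMap.add_apply, hu, hu']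
  | tmul a x =>
    induction v using TensorProduct.induction_on with
    | zero => simp
    | add v v' hv hv' => simp only [map_add, LinearMap.add_apply, hv, hv']
    | tmul b y =>
      rw [complexForm_tmul_tmul, complexForm_tmul_tmul, ← h.star_form x y, toComplex_star]
      simp only [map_mul, Complex.conj_conj]
      ring

theorem complexForm_baseChange {h : HermForm L} {k : HermForm M} (f : L →ₗ[Eisenstein] M) (c : ℤ)
    (hf : ∀ x y, k.form (f x) (f y) = c * h.form x y) (u v : ℂ ⊗[Eisenstein] L) :
    k.complexForm (f.baseChange ℂ u) (f.baseChange ℂ v) = c * h.complexForm u v := by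
  induction u using TensorProduct.induction_on with
  | zero => simp
  | add u u' hu hu' => simp only [map_add, LinearMap.add_apply, hu, hu', mul_add]
  | tmul a x =>
    induction v using TensorProduct.induction_on with
    | zero => simp
    | add v v' hv hv' => simp only [map_add, hv, hv', mul_add]
    | tmul b y =>
      rw [LinearMap.baseChange_tmul, LinearMap.baseChange_tmul, complexForm_tmul_tmul,
        complexForm_tmul_tmul, hf, map_mul, map_intCast]
      ring

theorem complexForm_eq_sum (h : HermForm L) {ι : Type*} [Fintype ι]
    (b : Module.Basis ι ℂ (ℂ ⊗[Eisenstein] L))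
    (hb : ∀ i j, i ≠ j → h.complexForm (b i) (b j) = 0) (u v : ℂ ⊗[Eisenstein] L) :
    h.complexForm u v = ∑ i, b.repr u i * conj (b.repr v i) * h.complexForm (b i) (b i) := by
  conv_lhs => rw [← b.sum_repr u, ← b.sum_repr v]
  rw [map_sum h.complexForm, LinearMap.sum_apply]
  refine Finset.sum_congr rfl fun i _ => ?_
  rw [map_sum, Finset.sum_eq_single i]
  · simp; ring
  · intro j _ hj
    simp [hb i j hj.symm]
  · simp

theorem HasSignature.eq_zero {h : HermForm L} {p n : ℕ} (hs : h.HasSignature p n)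
    {v : ℂ ⊗[Eisenstein] L} (hv : ∀ x : L, h.complexForm (1 ⊗ₜ x) v = 0) : v = 0 := by
  obtain ⟨b, hb, h1, h2⟩ := hs
  have hall : ∀ u, h.complexForm u v = 0 := by
    intro u
    induction u using TensorProduct.induction_on with
    | zero => simp
    | add u u' hu hu' => rw [map_add, LinearMap.add_apply, hu, hu', add_zero]
    | tmul a x =>
      have : a ⊗ₜ[Eisenstein] x = a • ((1 : ℂ) ⊗ₜ[Eisenstein] x) := by
        rw [TensorProduct.smul_tmul', smul_eq_mul, mul_one]
      rw [this, map_smul, LinearMap.smul_apply, hv, smul_zero]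
  classical
  apply b.repr.map_eq_zero_iff.1
  ext i
  have := hall (b i)
  rw [complexForm_eq_sum h b hb, Finset.sum_eq_single i] at this
  · rcases i with i | i
    · simpa [h1] using this
    · simpa [h2] using this
  · intro j _ hj
    simp [hj.symm]
  · simp

/-- By nondegeneracy, vectors of `L'` correspond to functionals on `L`, and `⟨x, θv⟩ = -θ⟨x, v⟩`.
One inclusion between `L` and `θL'` is thus divisibility by `θ`, the other representability of all
functionals. -/
theorem isThetaSelfDual_iff [Module.Free Eisenstein L] [Module.Finite Eisenstein L] {h : HermForm L}
    {p n : ℕ} (hs : h.HasSignature p n) : h.IsThetaSelfDual ↔ h.IsModular θ := by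
  set t := algebraMap Eisenstein ℂ θ with ht
  have ht0 : t ≠ 0 := algebraMap_θ_ne_zero
  have hconj : conj t = -t := by rw [ht, ← toComplex_star, star_θ, map_neg]
  have hθ : ∀ v : ℂ ⊗[Eisenstein] L, θ • v = t • v := fun v => (algebraMap_smul ℂ θ v).symm
  have hsmul : ∀ (x : L) (v : ℂ ⊗[Eisenstein] L),
      h.complexForm (1 ⊗ₜ x) (θ • v) = -t * h.complexForm (1 ⊗ₜ x) v := fun x v => by
    rw [hθ, LinearMap.map_smulₛₗ, hconj, smul_eq_mul]
  have hone : ∀ x y, h.complexForm (1 ⊗ₜ x) (1 ⊗ₜ y) = algebraMap Eisenstein ℂ (h.form x y) :=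
    fun x y => by simp
  constructor
  · intro hd
    refine ⟨fun x y => ?_, fun f => ?_⟩
    · have hy : (1 : ℂ) ⊗ₜ[Eisenstein] y ∈ h.image := ⟨y, rfl⟩
      rw [hd] at hy
      obtain ⟨v, hv, hvy⟩ := hy
      obtain ⟨c, hc⟩ := hv x
      refine ⟨-c, algebraMap_complex_injective ?_⟩
      have hvy : θ • v = 1 ⊗ₜ y := hvy
      rw [← hone, ← hvy, hsmul, hc, map_mul, map_neg]
      ring
    · let b := Module.Free.chooseBasis Eisenstein L
      obtain ⟨d, hd1, hd2, hd3⟩ := hs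
      classical
      let F : (ℂ ⊗[Eisenstein] L) →ₗ[ℂ] ℂ :=
        LinearMap.liftBaseChange ℂ (Algebra.linearMap Eisenstein ℂ ∘ₗ f)
      have hF : ∀ x : L, F (1 ⊗ₜ x) = algebraMap Eisenstein ℂ (f x) := fun x => by simp [F]
      -- The vector representing `F`, read off from the orthogonal basis, whose norms are `±1` and
      -- so equal to their inverses.
      let w : ℂ ⊗[Eisenstein] L := ∑ i, conj (F (d i) * h.complexForm (d i) (d i)) • d i
      have hdd : ∀ i, h.complexForm (d i) (d i) * h.complexForm (d i) (d i) = 1 := by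
        rintro (i | i)
        · simp [hd2]
        · simp [hd3]
      have hw : ∀ u, h.complexForm u w = F u := by
        intro u
        have : F = (h.complexForm.flip w) := by
          apply d.ext
          intro i
          rw [LinearMap.flip_apply, map_sum, Finset.sum_eq_single i]
          · rw [LinearMap.map_smulₛₗ, Complex.conj_conj, smul_eq_mul, mul_assoc, hdd, mul_one]
          · intro j _ hj
            rw [LinearMap.map_smulₛₗ, hd1 i j hj.symm, smul_zero]
          · simp
        rw [this]; rfl
      have hmem : θ • w ∈ h.image := by
        rw [hd]
        exact ⟨w, fun x => ⟨f x, by rw [hw, hF]⟩, rfl⟩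
      obtain ⟨y, hy⟩ := hmem
      have hy : 1 ⊗ₜ y = θ • w := hy
      refine ⟨-y, fun x => algebraMap_complex_injective ?_⟩
      rw [map_neg, map_neg, ← hone, hy, hsmul, hw, hF, map_mul]
      ring
  · intro hm
    apply le_antisymm
    · rintro _ ⟨y, rfl⟩
      refine ⟨t⁻¹ • (1 ⊗ₜ y), fun x => ?_, ?_⟩
      · obtain ⟨c, hc⟩ := hm.dvd x y
        refine ⟨-c, ?_⟩
        rw [LinearMap.map_smulₛₗ, hone, hc, map_mul, map_inv₀, hconj, smul_eq_mul, map_neg]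
        field_simp
        rfl
      · change θ • (t⁻¹ • ((1 : ℂ) ⊗ₜ[Eisenstein] y)) = 1 ⊗ₜ y
        rw [hθ, smul_smul, mul_inv_cancel₀ ht0, one_smul]
    · rintro _ ⟨v, hv, rfl⟩
      choose f hf using hv
      obtain ⟨y, hy⟩ := hm.exists_form_eq
        { toFun := f
          map_add' := fun x x' => algebraMap_complex_injective (by
            rw [map_add, ← hf, ← hf, ← hf, TensorProduct.tmul_add, map_add, LinearMap.add_apply])
          map_smul' := fun r x => algebraMap_complex_injective (by
            rw [← hf, RingHom.id_apply, smul_eq_mul, map_mul, ← hf, TensorProduct.tmul_smul,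
              ← algebraMap_smul ℂ r, map_smul, LinearMap.smul_apply, smul_eq_mul]) }
      refine ⟨-y, ?_⟩
      change (1 : ℂ) ⊗ₜ[Eisenstein] (-y) = θ • v
      rw [← sub_eq_zero]
      apply hs.eq_zero
      intro x
      rw [map_sub, hone, hsmul, map_neg, hy, hf]
      simp [ht]

end HermForm

end

/-! ### Signatures -/

noncomputable section

namespace HermForm

open Eisenstein

variable {L : Type*} [AddCommGroup L] [Module Eisenstein L]
variable {M : Type*} [AddCommGroup M] [Module Eisenstein M]

theorem exists_sum_equiv_fin {ι : Type*} [Fintype ι] (P : ι → Prop) :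
    ∃ (p n : ℕ) (e : Fin p ⊕ Fin n ≃ ι), (∀ i, P (e (Sum.inl i))) ∧ ∀ j, ¬ P (e (Sum.inr j)) := by
  classical
  refine ⟨_, _, ((Fintype.equivFin {i // P i}).symm.sumCongr
    (Fintype.equivFin {i // ¬ P i}).symm).trans (Equiv.sumCompl P), fun i => ?_, fun j => ?_⟩
  · simpa using ((Fintype.equivFin {i // P i}).symm i).2
  · simpa using ((Fintype.equivFin {i // ¬ P i}).symm j).2

theorem complexForm_smul_left (h : HermForm L) (a : ℂ) (u v : ℂ ⊗[Eisenstein] L) :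
    h.complexForm (a • u) v = a * h.complexForm u v := by
  rw [map_smul, LinearMap.smul_apply, smul_eq_mul]

theorem complexForm_smul_right (h : HermForm L) (a : ℂ) (u v : ℂ ⊗[Eisenstein] L) :
    h.complexForm u (a • v) = conj a * h.complexForm u v := by
  rw [LinearMap.map_smulₛₗ, smul_eq_mul]

theorem HasSignature.of_basis {h : HermForm L} {ι : Type*} [Fintype ι]
    (b : Module.Basis ι ℂ (ℂ ⊗[Eisenstein] L))
    (hb : ∀ i j, i ≠ j → h.complexForm (b i) (b j) = 0)
    (h1 : ∀ i, h.complexForm (b i) (b i) = 1 ∨ h.complexForm (b i) (b i) = -1) :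
    ∃ p n, h.HasSignature p n := by
  obtain ⟨p, n, e, hp, hn⟩ := exists_sum_equiv_fin fun i => h.complexForm (b i) (b i) = 1
  refine ⟨p, n, b.reindex e.symm, fun i j hij => ?_, fun i => ?_, fun j => ?_⟩
  · simpa using hb _ _ (e.injective.ne hij)
  · simpa using hp i
  · simpa using (h1 _).resolve_left (hn j)

theorem HasSignature.of_family {h : HermForm L} {ι : Type*} [Fintype ι]
    [Module.Free Eisenstein L] [Module.Finite Eisenstein L] {p n : ℕ}
    (v : ι → ℂ ⊗[Eisenstein] L) (e : Fin p ⊕ Fin n ≃ ι)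
    (hrank : Module.finrank Eisenstein L = p + n)
    (hv : ∀ i j, i ≠ j → h.complexForm (v i) (v j) = 0)
    (h1 : ∀ i, h.complexForm (v (e (Sum.inl i))) (v (e (Sum.inl i))) = 1)
    (h2 : ∀ i, h.complexForm (v (e (Sum.inr i))) (v (e (Sum.inr i))) = -1) :
    h.HasSignature p n := by
  have hli : LinearIndependent ℂ (v ∘ e) := by
    rw [Fintype.linearIndependent_iff]
    intro g hg i
    have := congrArg (fun u => h.complexForm u (v (e i))) hg
    simp only [map_sum, LinearMap.sum_apply, map_smul, LinearMap.smul_apply, map_zero,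
      LinearMap.zero_apply, Function.comp_apply] at this
    rw [Finset.sum_eq_single i] at this
    · rcases i with i | i
      · simpa [h1] using this
      · simpa [h2] using this
    · intro j _ hj
      rw [hv _ _ (e.injective.ne hj), smul_zero]
    · simp
  have hspan := hli.span_eq_top_of_card_eq_finrank' (by
    rw [Module.finrank_baseChange, hrank]; simp)
  refine ⟨Module.Basis.mk hli hspan.ge, fun i j hij => ?_, fun i => ?_, fun j => ?_⟩
  · simpa using hv _ _ (e.injective.ne hij)
  · simpa using h1 i
  · simpa using h2 j

theorem HasSignature.finrank_eq [Module.Free Eisenstein L] {h : HermForm L} {p n : ℕ}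
    (hs : h.HasSignature p n) : Module.finrank Eisenstein L = p + n := by
  obtain ⟨b, -⟩ := hs
  rw [← Module.finrank_baseChange (R := ℂ), Module.finrank_eq_card_basis b]
  simp

theorem complexForm_self_eq {h : HermForm L} {p n : ℕ}
    {b : Module.Basis (Fin p ⊕ Fin n) ℂ (ℂ ⊗[Eisenstein] L)}
    (hb : ∀ i j, i ≠ j → h.complexForm (b i) (b j) = 0)
    (h1 : ∀ i, h.complexForm (b (Sum.inl i)) (b (Sum.inl i)) = 1)
    (h2 : ∀ j, h.complexForm (b (Sum.inr j)) (b (Sum.inr j)) = -1) (v : ℂ ⊗[Eisenstein] L) :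
    (h.complexForm v v).re =
      ∑ i, ‖b.repr v (Sum.inl i)‖ ^ 2 - ∑ j, ‖b.repr v (Sum.inr j)‖ ^ 2 := by
  rw [complexForm_eq_sum h b hb, Fintype.sum_sum_type]
  simp only [h1, h2, Complex.mul_conj, mul_one, mul_neg, Complex.add_re, Complex.re_sum,
    Complex.neg_re, Complex.ofReal_re, Finset.sum_neg_distrib, Complex.normSq_eq_norm_sq]
  ring

/-- One half of Sylvester's law of inertia. -/
theorem HasSignature.le_of_map {h : HermForm L} {k : HermForm M} {p n p' n' : ℕ}
    (hs : h.HasSignature p n) (hs' : k.HasSignature p' n') (f : L →ₗ[Eisenstein] M) {c : ℤ}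
    (hc : 0 < c) (hf : ∀ x y, k.form (f x) (f y) = c * h.form x y) : p ≤ p' := by
  obtain ⟨b, hb, hb1, hb2⟩ := hs
  obtain ⟨b', hb', hb1', hb2'⟩ := hs'
  let incl : (Fin p → ℂ) →ₗ[ℂ] (ℂ ⊗[Eisenstein] L) :=
    Fintype.linearCombination ℂ fun i => b (Sum.inl i)
  let proj : (ℂ ⊗[Eisenstein] M) →ₗ[ℂ] (Fin p' → ℂ) :=
    LinearMap.pi fun i => b'.coord (Sum.inl i)
  -- A vector of the positive subspace killed by `T` has an image of norm at most 0, yet `c` times a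
  -- nonnegative norm; so it vanishes. The factor `c` is allowed because `K ⊆ L` will scale the form
  -- by 3.
  let T := proj ∘ₗ f.baseChange ℂ ∘ₗ incl
  have hrepr : ∀ x i, b.repr (incl x) i = Sum.elim x 0 i := by
    intro x i
    have : incl x = b.equivFun.symm (Sum.elim x 0) := by
      rw [b.equivFun_symm_apply]
      simp [incl, Fintype.linearCombination_apply, Fintype.sum_sum_type]
    rw [this, ← b.equivFun_apply, LinearEquiv.apply_symm_apply]
  have hT : Function.Injective T := by
    rw [← LinearMap.ker_eq_bot, LinearMap.ker_eq_bot']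
    intro x hx
    have hx' : ∀ i, b'.repr (f.baseChange ℂ (incl x)) (Sum.inl i) = 0 := fun i => congrFun hx i
    have e1 := complexForm_self_eq hb hb1 hb2 (incl x)
    have e2 := complexForm_self_eq hb' hb1' hb2' (f.baseChange ℂ (incl x))
    rw [complexForm_baseChange f c hf] at e2
    simp only [hx', hrepr] at e1 e2
    simp at e1 e2
    have h0 : 0 ≤ ∑ j, ‖b'.repr (f.baseChange ℂ (incl x)) (Sum.inr j)‖ ^ 2 := by positivity
    have h1 : ∑ i, ‖x i‖ ^ 2 ≤ 0 := by
      rw [← e1]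
      have hc' : (0 : ℝ) < c := by exact_mod_cast hc
      nlinarith
    have h2 := (Finset.sum_eq_zero_iff_of_nonneg fun i _ => by positivity).1
      (le_antisymm h1 (by positivity))
    funext i
    simpa using h2 i (Finset.mem_univ i)
  simpa using LinearMap.finrank_le_finrank_of_injective hT

/-- The signature is determined by the lattice. -/
theorem HasSignature.eq_of_isometry [Module.Free Eisenstein L] [Module.Free Eisenstein M]
    {h : HermForm L} {k : HermForm M} {p n p' n' : ℕ}
    (hs : h.HasSignature p n) (hs' : k.HasSignature p' n') (e : Isometry h k) :
    p = p' ∧ n = n' := by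
  have h1 := hs.le_of_map hs' e.toLinearEquiv.toLinearMap one_pos
    (fun x y => by simpa using e.map_form x y)
  have h2 := hs'.le_of_map hs e.symm.toLinearEquiv.toLinearMap one_pos
    (fun x y => by simpa using e.symm.map_form x y)
  have h3 := e.toLinearEquiv.finrank_eq
  rw [hs.finrank_eq, hs'.finrank_eq] at h3
  omega

/-- Semidefiniteness passes from `L` to the fractions `x / T`, which are dense in `ℂ ⊗ L`, and then
to limits. The values `s = 1` and `s = -1` cover both signs, showing that positive or negative
vectors of `ℂ ⊗ L` force such vectors in `L`. -/
theorem mul_complexForm_self_nonpos [Module.Free Eisenstein L] [Module.Finite Eisenstein L]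
    {h : HermForm L} {s : ℤ} (hs : ∀ x, s * h.normSq x ≤ 0) (v : ℂ ⊗[Eisenstein] L) :
    s * (h.complexForm v v).re ≤ 0 := by
  let b := Module.Free.chooseBasis Eisenstein L
  let F : (Module.Free.ChooseBasisIndex Eisenstein L → ℂ) → ℝ := fun z =>
    s * (∑ i, ∑ j, z i * conj (z j) * algebraMap Eisenstein ℂ (h.form (b i) (b j))).re
  have hF : ∀ z, F z = s * (h.complexForm (∑ i, z i ⊗ₜ b i) (∑ i, z i ⊗ₜ b i)).re := by
    intro z
    simp only [F]
    congr 2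
    rw [map_sum h.complexForm, LinearMap.sum_apply]
    refine Finset.sum_congr rfl fun i _ => ?_
    rw [map_sum]
    exact Finset.sum_congr rfl fun j _ => by rw [complexForm_tmul_tmul]
  have hcont : Continuous F := by
    simp only [F]
    refine continuous_const.mul (Complex.continuous_re.comp ?_)
    refine continuous_finsetSum _ fun i _ => continuous_finsetSum _ fun j _ => ?_
    exact ((continuous_apply i).mul (Complex.continuous_conj.comp (continuous_apply j))).mul
      continuous_const
  obtain ⟨z, rfl⟩ : ∃ z : Module.Free.ChooseBasisIndex Eisenstein L → ℂ, v = ∑ i, z i ⊗ₜ b i := by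
    refine ⟨fun i => (b.baseChange ℂ).repr v i, ?_⟩
    conv_lhs => rw [← (b.baseChange ℂ).sum_repr v]
    refine Finset.sum_congr rfl fun i _ => ?_
    rw [Module.Basis.baseChange_apply, TensorProduct.smul_tmul', smul_eq_mul, mul_one]
  rw [← hF]
  choose a ha using fun i => exists_tendsto_complex (z i)
  have hlim := (hcont.tendsto z).comp (tendsto_pi_nhds.2 ha)
  refine le_of_tendsto hlim (Filter.Eventually.of_forall fun T => ?_)
  have hsum : (∑ i, ((T : ℂ)⁻¹ * algebraMap Eisenstein ℂ (a i T)) ⊗ₜ[Eisenstein] b i) =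
      (T : ℂ)⁻¹ • ((1 : ℂ) ⊗ₜ[Eisenstein] ∑ i, a i T • b i) := by
    rw [TensorProduct.tmul_sum, Finset.smul_sum]
    refine Finset.sum_congr rfl fun i _ => ?_
    rw [TensorProduct.tmul_smul, TensorProduct.smul_tmul', TensorProduct.smul_tmul',
      smul_eq_mul, Algebra.smul_def, mul_one]
  rw [Function.comp_apply, hF, hsum, complexForm_smul_left, complexForm_smul_right,
    complexForm_tmul_tmul, form_self, map_intCast]
  have h1 := hs (∑ i, a i T • b i)
  have h2 : ((s : ℝ) * (h.normSq (∑ i, a i T • b i) : ℝ)) ≤ 0 := by exact_mod_cast h1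
  have h3 : ((T : ℂ)⁻¹ * (conj (T : ℂ)⁻¹ * ((1 : ℂ) * conj (1 : ℂ) *
      ((h.normSq (∑ i, a i T • b i) : ℤ) : ℂ)))) =
      (((T : ℝ)⁻¹ ^ 2 * (h.normSq (∑ i, a i T • b i) : ℝ) : ℝ) : ℂ) := by
    simp; ring
  rw [h3, Complex.ofReal_re]
  nlinarith [sq_nonneg ((T : ℝ)⁻¹)]

theorem HasSignature.exists_normSq_pos [Module.Free Eisenstein L] [Module.Finite Eisenstein L]
    {h : HermForm L} {p n : ℕ} (hs : h.HasSignature p n) (hp : 0 < p) : ∃ x, 0 < h.normSq x := by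
  by_contra! hcon
  obtain ⟨b, -, h1, -⟩ := hs
  have := mul_complexForm_self_nonpos (s := 1) (by simpa using hcon) (b (Sum.inl ⟨0, hp⟩))
  rw [h1] at this
  norm_num at this

theorem HasSignature.exists_normSq_neg [Module.Free Eisenstein L] [Module.Finite Eisenstein L]
    {h : HermForm L} {p n : ℕ} (hs : h.HasSignature p n) (hn : 0 < n) : ∃ x, h.normSq x < 0 := by
  by_contra! hcon
  obtain ⟨b, -, -, h2⟩ := hs
  have := mul_complexForm_self_nonpos (s := -1) (by simpa using hcon) (b (Sum.inr ⟨0, hn⟩))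
  rw [h2] at this
  norm_num at this

/-- A modular lattice has a signature. -/
theorem IsModular.exists_hasSignature [Module.Free Eisenstein L] [Module.Finite Eisenstein L]
    {h : HermForm L} {c : Eisenstein} (hc : c ≠ 0) (hh : h.IsModular c) :
    ∃ p n, h.HasSignature p n := by
  classical
  let b := Module.Free.chooseBasis Eisenstein L
  let ι := Module.Free.ChooseBasisIndex Eisenstein L
  let A : Matrix ι ι ℂ := Matrix.of fun i j => algebraMap Eisenstein ℂ (h.form (b j) (b i))
  have hA : A.IsHermitian := by
    ext i j
    rw [Matrix.conjTranspose_apply, Complex.star_def]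
    simp only [A, Matrix.of_apply]
    rw [← toComplex_star, h.star_form]
  let w : (ι → ℂ) ≃ₗ[ℂ] (ℂ ⊗[Eisenstein] L) := (b.baseChange ℂ).equivFun.symm
  have hw : ∀ x, w x = ∑ i, x i ⊗ₜ b i := fun x => by
    simp only [w, Module.Basis.equivFun_symm_apply]
    refine Finset.sum_congr rfl fun i _ => ?_
    rw [Module.Basis.baseChange_apply, TensorProduct.smul_tmul', smul_eq_mul, mul_one]
  have hform : ∀ x y, h.complexForm (w x) (w y) = (A.mulVec x) ⬝ᵥ (star y) := by
    intro x y
    rw [hw, hw, map_sum h.complexForm, LinearMap.sum_apply]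
    simp only [map_sum, complexForm_tmul_tmul, dotProduct, Matrix.mulVec, A, Matrix.of_apply,
      Finset.sum_mul, Pi.star_apply, Complex.star_def]
    rw [Finset.sum_comm]
    exact Finset.sum_congr rfl fun i _ => Finset.sum_congr rfl fun j _ => by ring
  -- Modularity makes every coordinate functional, times `c ≠ 0`, a pairing with a lattice vector.
  -- So the Gram matrix is nonsingular, and its orthonormal eigenvectors, divided by `√|λ|`, have
  -- norms `±1`.
  have hinj : ∀ x, A.mulVec x = 0 → x = 0 := by
    intro x hx
    funext k
    obtain ⟨y, hy⟩ := hh.exists_form_eq (b.coord k)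
    have h0 : h.complexForm (w x) (1 ⊗ₜ y) = 0 := by
      rw [← w.apply_symm_apply (1 ⊗ₜ y), hform, hx, zero_dotProduct]
    rw [hw, map_sum h.complexForm, LinearMap.sum_apply] at h0
    simp only [complexForm_tmul_tmul, hy, map_one, mul_one, map_mul] at h0
    rw [Finset.sum_eq_single k] at h0
    · have hc' : algebraMap Eisenstein ℂ c ≠ 0 := fun h =>
        hc (algebraMap_complex_injective (h.trans (map_zero _).symm))
      simpa [hc'] using h0
    · intro j _ hj
      simp [hj]
    · simp
  let E := hA.eigenvectorBasis
  have hE : ∀ i, A.mulVec (E i).ofLp = (hA.eigenvalues i : ℂ) • (E i).ofLp := fun i =>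
    hA.mulVec_eigenvectorBasis i
  have hne : ∀ i, hA.eigenvalues i ≠ 0 := by
    intro i hi
    have h1 := hE i
    rw [hi] at h1
    have h2 := hinj _ (by rw [h1]; simp)
    exact E.toBasis.ne_zero i (by simpa using congrArg (WithLp.toLp 2) h2)
  have hortho : ∀ i j, (E i).ofLp ⬝ᵥ star (E j).ofLp = if j = i then 1 else 0 := fun i j => by
    rw [← EuclideanSpace.inner_eq_star_dotProduct]
    exact orthonormal_iff_ite.1 E.orthonormal j i
  have hEE : ∀ i j, h.complexForm (w (E i).ofLp) (w (E j).ofLp) =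
      if j = i then (hA.eigenvalues i : ℂ) else 0 := fun i j => by
    rw [hform, hE, smul_dotProduct, hortho]
    simp
  let r : ι → ℝ := fun i => (Real.sqrt |hA.eigenvalues i|)⁻¹
  have hr : ∀ i, r i ^ 2 * |hA.eigenvalues i| = 1 := fun i => by
    have h0 := abs_pos.2 (hne i)
    simp only [r]
    rw [inv_pow, Real.sq_sqrt h0.le, inv_mul_cancel₀ h0.ne']
  have hr0 : ∀ i, r i ≠ 0 := fun i h0 => by
    have := hr i
    rw [h0] at this
    simp at this
  let B := (E.toBasis.map ((WithLp.linearEquiv 2 ℂ (ι → ℂ)).trans w)).isUnitSMul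
    (w := fun i => (r i : ℂ)) (fun i => (by exact_mod_cast hr0 i : (r i : ℂ) ≠ 0).isUnit)
  have hB : ∀ i, B i = (r i : ℂ) • w (E i).ofLp := fun i => by
    simp [B, Module.Basis.isUnitSMul_apply]
  have hBB : ∀ i j, h.complexForm (B i) (B j) =
      (r i : ℂ) * ((r j : ℂ) * if j = i then (hA.eigenvalues i : ℂ) else 0) := fun i j => by
    rw [hB, hB, complexForm_smul_left, complexForm_smul_right, hEE, Complex.conj_ofReal]
  refine HasSignature.of_basis B (fun i j hij => ?_) fun i => ?_
  · rw [hBB, if_neg hij.symm]; simp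
  · rw [hBB, if_pos rfl]
    rcases abs_choice (hA.eigenvalues i) with h1 | h1
    · left
      rw [← h1]
      have := hr i
      rw [h1] at this
      rw [h1]
      exact_mod_cast (by rw [← this]; ring : r i * (r i * hA.eigenvalues i) = 1)
    · right
      have := hr i
      rw [h1] at this
      exact_mod_cast (by rw [← this]; ring : r i * (r i * hA.eigenvalues i) = -1)

end HermForm

end

/-! ### Signature and orbits of `ρ^⊥/⟨ρ⟩` -/

noncomputable section

namespace HermForm

open Eisenstein

variable {L : Type*} [AddCommGroup L] [Module Eisenstein L]
variable {M : Type*} [AddCommGroup M] [Module Eisenstein M]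

theorem HasSignature.hyp [Module.Free Eisenstein L] [Module.Finite Eisenstein L] {k : HermForm L}
    {p n : ℕ} (hs : k.HasSignature p n) : k.hyp.HasSignature (p + 1) (n + 1) := by
  have hrank := hs.finrank_eq
  obtain ⟨b, hb, h1, h2⟩ := hs
  set t := algebraMap Eisenstein ℂ θ with ht
  have htt : t * t = -3 := by rw [ht, ← map_mul, θ_mul_θ, map_neg, map_ofNat]
  have hconj : conj t = -t := by rw [ht, ← toComplex_star, star_θ, map_neg]
  have hc : conj (t / 6) = -t / 6 := by rw [map_div₀, hconj, map_ofNat]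
  have hc' : conj (-t / 6) = t / 6 := by rw [map_div₀, map_neg, hconj, map_ofNat, neg_neg]
  let V := ℂ ⊗[Eisenstein] (Eisenstein × Eisenstein × L)
  let J : (ℂ ⊗[Eisenstein] L) →ₗ[ℂ] V :=
    (LinearMap.inr Eisenstein Eisenstein _ ∘ₗ LinearMap.inr Eisenstein Eisenstein L).baseChange ℂ
  have hJ : ∀ u v, k.hyp.complexForm (J u) (J v) = k.complexForm u v := fun u v => by
    have := complexForm_baseChange (h := k) (k := k.hyp)
      (LinearMap.inr Eisenstein Eisenstein _ ∘ₗ LinearMap.inr Eisenstein Eisenstein L) 1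
      (fun x y => by simp [hyp_form]) u v
    simpa using this
  -- The pairing of `w a` and `w a'` is `(a - conj a')θ`. As `θ² = -3`, the choices `a = -θ/6` and
  -- `a = θ/6` give norms 1 and -1 and are orthogonal.
  let w : ℂ → V := fun a => a ⊗ₜ (1, 0, 0) + 1 ⊗ₜ (0, 1, 0)
  have hww : ∀ a a', k.hyp.complexForm (w a) (w a') = (a - conj a') * t := fun a a' => by
    simp only [w, map_add, LinearMap.add_apply, complexForm_tmul_tmul, hyp_form]
    simp [← ht]
    ring
  have hwJ : ∀ a u, k.hyp.complexForm (w a) (J u) = 0 := fun a u => by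
    induction u using TensorProduct.induction_on with
    | zero => simp
    | add u v hu hv => rw [J.map_add, (k.hyp.complexForm (w a)).map_add, hu, hv, add_zero]
    | tmul c x =>
      have hJc : J (c ⊗ₜ x) = c ⊗ₜ (0, 0, x) := LinearMap.baseChange_tmul _ _ _
      rw [hJc]
      simp only [w, map_add, LinearMap.add_apply, complexForm_tmul_tmul, hyp_form]
      simp
  have hJw : ∀ a u, k.hyp.complexForm (J u) (w a) = 0 := fun a u => by
    rw [← complexForm_star, hwJ, map_zero]
  let v : Option (Fin p) ⊕ Option (Fin n) → V := Sum.elim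
    (fun o => o.elim (w (-t / 6)) fun i => J (b (Sum.inl i)))
    (fun o => o.elim (w (t / 6)) fun i => J (b (Sum.inr i)))
  refine HasSignature.of_family v ((finSuccEquiv p).sumCongr (finSuccEquiv n)) ?_ ?_ ?_ ?_
  · rw [Module.finrank_prod, Module.finrank_prod, Module.finrank_self, hrank]; ring
  · rintro ((_ | i) | (_ | i)) ((_ | j) | (_ | j)) hij <;>
      simp only [v, Sum.elim_inl, Sum.elim_inr, Option.elim_none, Option.elim_some, hJw, hwJ, hww,
        hJ] <;>
      first
      | exact absurd rfl hij
      | (apply hb; simp_all)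
      | (rw [hc]; ring)
      | (rw [hc']; ring)
  · intro i
    rw [Equiv.sumCongr_apply, Sum.map_inl]
    generalize finSuccEquiv p i = o
    rcases o with _ | i
    · simp only [v, Sum.elim_inl, Option.elim_none, hww]
      rw [hc']
      linear_combination (-1 / 3 : ℂ) * htt
    · simp only [v, Sum.elim_inl, Option.elim_some, hJ, h1]
  · intro i
    rw [Equiv.sumCongr_apply, Sum.map_inr]
    generalize finSuccEquiv n i = o
    rcases o with _ | i
    · simp only [v, Sum.elim_inr, Option.elim_none, hww]
      rw [hc]
      linear_combination (1 / 3 : ℂ) * htt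
    · simp only [v, Sum.elim_inr, Option.elim_some, hJ, h2]

variable [Module.Free Eisenstein M] [Module.Finite Eisenstein M]

theorem IsModular.free_quot {h : HermForm M} (hh : h.IsModular θ) {ρ : M}
    (hρ : h.IsPrimitiveNull ρ) : Module.Free Eisenstein (h.Quot ρ) := by
  obtain ⟨e, -⟩ := hh.exists_isometry_hyp hρ
  let f : h.Quot ρ →ₗ[Eisenstein] M := e.toLinearEquiv.toLinearMap ∘ₗ
    LinearMap.inr Eisenstein Eisenstein _ ∘ₗ LinearMap.inr Eisenstein Eisenstein _
  have hf : Function.Injective f := by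
    refine e.toLinearEquiv.injective.comp ?_
    intro x y hxy
    simpa using hxy
  exact Module.Free.of_equiv (LinearEquiv.ofInjective f hf).symm

/-- The quotient is modular and so has some signature; adding the plane raises both entries by one,
and Sylvester's law compares the result with `(p, n)`. -/
theorem IsModular.hasSignature_quotForm {h : HermForm M} (hh : h.IsModular θ) {p n : ℕ}
    (hs : h.HasSignature p n) {ρ : M} (hρ : h.IsPrimitiveNull ρ) :
    (h.quotForm ρ).HasSignature (p - 1) (n - 1) := by
  have := hh.free_quot hρ
  obtain ⟨e, -⟩ := hh.exists_isometry_hyp hρ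
  obtain ⟨p', n', hs'⟩ := (isModular_hyp_iff.1 (e.symm.isModular hh)).exists_hasSignature θ_ne_zero
  obtain ⟨rfl, rfl⟩ := hs.eq_of_isometry hs'.hyp e.symm
  exact hs'

theorem IsModular.exists_mem_aut_iff {h : HermForm M} (hh : h.IsModular θ) {ρ₁ ρ₂ : M}
    (h₁ : h.IsPrimitiveNull ρ₁) (h₂ : h.IsPrimitiveNull ρ₂) :
    (∃ g ∈ h.aut, g ρ₁ = ρ₂) ↔ Nonempty (Isometry (h.quotForm ρ₁) (h.quotForm ρ₂)) := by
  obtain ⟨e₁, he₁⟩ := hh.exists_isometry_hyp h₁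
  obtain ⟨e₂, he₂⟩ := hh.exists_isometry_hyp h₂
  constructor
  · rintro ⟨g, hg, hgρ⟩
    let g' : Isometry h h := ⟨g, hg⟩
    obtain ⟨i⟩ := (e₁.trans g').nonempty_quotForm
    have : (e₁.trans g').toLinearEquiv (1, 0, 0) = ρ₂ :=
      (congrArg g he₁).trans hgρ
    rw [this] at i
    exact ⟨i.symm⟩
  · rintro ⟨i⟩
    let j : Isometry (h.quotForm ρ₁).hyp (h.quotForm ρ₂).hyp :=
      { toLinearEquiv := (LinearEquiv.refl _ _).prodCongr
          ((LinearEquiv.refl _ _).prodCongr i.toLinearEquiv)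
        map_form' := fun x y => by
          change (h.quotForm ρ₂).hyp.form (x.1, x.2.1, i.toLinearEquiv x.2.2)
            (y.1, y.2.1, i.toLinearEquiv y.2.2) = _
          rw [hyp_form, hyp_form, i.map_form] }
    let g := (e₁.symm.trans j).trans e₂
    refine ⟨g.toLinearEquiv, fun x y => g.map_form x y, ?_⟩
    have h0 : e₁.toLinearEquiv.symm ρ₁ = (1, 0, 0) := by
      rw [LinearEquiv.symm_apply_eq, he₁]
    have h1 : j.toLinearEquiv (1, 0, 0) = (1, 0, 0) := by
      change ((1 : Eisenstein), (0 : Eisenstein), i.toLinearEquiv 0) = _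
      rw [map_zero]
    change e₂.toLinearEquiv (j.toLinearEquiv (e₁.toLinearEquiv.symm ρ₁)) = ρ₂
    rw [h0, h1, he₂]

end HermForm

end

/-! ### Indefinite unimodular lattices -/

noncomputable section

namespace HermForm

open Eisenstein

variable {N : Type*} [AddCommGroup N] [Module Eisenstein N]

theorem normSq_pos_sub {g : HermForm N} {x y : N} (hx : 0 < g.normSq x) (hy : g.normSq y < 0) :
    ∃ z, g.form x z = 0 ∧ g.normSq z < 0 := by
  have hyx : g.form y x * g.form x y = ((g.form y x).norm : Eisenstein) := by
    rw [← g.star_form y x, mul_star_eq]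
  -- The projection of `y` orthogonal to `x`, with denominators cleared.
  refine ⟨(g.normSq x : Eisenstein) • y - g.form y x • x, ?_, ?_⟩
  · rw [form_sub_right, form_smul_right, form_smul_right, g.star_form, star_intCast, form_self]
    ring
  · have h1 : g.normSq ((g.normSq x : Eisenstein) • y - g.form y x • x) =
        g.normSq x * (g.normSq x * g.normSq y - (g.form y x).norm) := by
      rw [normSq_eq_iff]
      push_cast
      have hxx := g.form_self x
      have hyy := g.form_self y
      simp only [form_sub_left, form_sub_right, form_smul_left, form_smul_right, g.star_form,
        star_intCast, hxx, hyy]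
      linear_combination (-(g.normSq x : Eisenstein)) * hyx
    rw [h1]
    have := norm_nonneg (g.form y x)
    nlinarith [mul_neg_of_pos_of_neg hx hy]

theorem exists_null_of_orthogonal {g : HermForm N} {x y z : N} (hx : 0 < g.normSq x)
    (hy : g.normSq y < 0) (hz : g.normSq z ≠ 0) (hxy : g.form x y = 0) (hzx : g.form z x = 0)
    (hzy : g.form z y = 0) : ∃ v, v ≠ 0 ∧ g.form v v = 0 := by
  have hyx : g.form y x = 0 := by rw [← g.star_form, hxy, star_zero]
  have hxz : g.form x z = 0 := by rw [← g.star_form, hzx, star_zero]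
  have hyz : g.form y z = 0 := by rw [← g.star_form, hzy, star_zero]
  obtain ⟨a, b, c, h0, h⟩ := exists_isotropic_ternary hx hy hz
  refine ⟨a • x + b • y + c • z, fun hv => ?_, ?_⟩
  · have e1 := congrArg (fun v => g.form v x) hv
    have e2 := congrArg (fun v => g.form v y) hv
    have e3 := congrArg (fun v => g.form v z) hv
    simp only [form_add_left, form_smul_left, hxy, hyx, hzx, hxz, hzy, hyz, form_self] at e1 e2 e3
    simp [hx.ne', hy.ne, hz] at e1 e2 e3
    tauto
  · have hxx := g.form_self x
    have hyy := g.form_self y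
    have hzz := g.form_self z
    simp only [form_add_left, form_smul_left, form_add_right, form_smul_right, hxy, hyx, hzx, hxz,
      hzy, hyz, hxx, hyy, hzz]
    have h' := congrArg (Int.cast : ℤ → Eisenstein) h
    push_cast at h'
    rw [← mul_star_eq, ← mul_star_eq, ← mul_star_eq] at h'
    linear_combination h'

/-- Ternary isotropy does not apply in rank 2, and unimodularity replaces it: the determinant is
`±1`, and completing the square shows that an indefinite form has determinant -1, so that `a` times
the form is a difference of two norms. -/
theorem IsModular.exists_null_of_basis_fin_two {g : HermForm N} (hg : g.IsModular 1)
    (e : Module.Basis (Fin 2) Eisenstein N) {x y : N} (hx : 0 < g.normSq x) (hy : g.normSq y < 0) :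
    ∃ v, v ≠ 0 ∧ g.form v v = 0 := by
  set a := g.normSq (e 0) with ha
  set c := g.normSq (e 1) with hc
  set b := g.form (e 0) (e 1) with hb
  have hb' : g.form (e 1) (e 0) = star b := (g.star_form _ _).symm
  have hbb : b * star b = (b.norm : Eisenstein) := mul_star_eq b
  have hv : ∀ v, v = e.repr v 0 • e 0 + e.repr v 1 • e 1 := fun v => by
    conv_lhs => rw [← e.sum_repr v, Fin.sum_univ_two]
  -- The vectors representing the two coordinate functionals give an inverse of the Gram matrix, so
  -- its determinant is a unit.
  have hdet : a * c - b.norm = 1 ∨ a * c - b.norm = -1 := by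
    obtain ⟨u, hu⟩ := hg.exists_form_eq (e.coord 0)
    obtain ⟨w, hw⟩ := hg.exists_form_eq (e.coord 1)
    have u0 := hu (e 0)
    have u1 := hu (e 1)
    have w0 := hw (e 0)
    have w1 := hw (e 1)
    rw [hv u] at u0 u1
    rw [hv w] at w0 w1
    simp only [form_add_right, form_smul_right, form_self, ← ha, ← hb, ← hc, hb'] at u0 u1 w0 w1
    simp at u0 u1 w0 w1
    have hmul : ((a * c - b.norm : ℤ) : Eisenstein) *
        (star (e.repr u 0) * star (e.repr w 1) - star (e.repr u 1) * star (e.repr w 0)) = 1 := by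
      push_cast
      rw [← hbb]
      linear_combination (star (e.repr w 0) * star b + star (e.repr w 1) * c) * u0 + w1 -
        (star (e.repr w 0) * a + star (e.repr w 1) * b) * u1
    have h1 := congrArg QuadraticAlgebra.norm hmul
    rw [map_mul, QuadraticAlgebra.norm_intCast, QuadraticAlgebra.norm_one, Int.cast_id, pow_two, mul_assoc] at h1
    exact Int.isUnit_iff.1 (IsUnit.of_mul_eq_one _ h1)
  have key : ∀ v, a * g.normSq v = (g.form v (e 0)).norm + (a * c - b.norm) * (e.repr v 1).norm := by
    intro v
    have : ((a * g.normSq v : ℤ) : Eisenstein) =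
        (((g.form v (e 0)).norm + (a * c - b.norm) * (e.repr v 1).norm : ℤ) : Eisenstein) := by
      push_cast
      have hff := congrArg (fun z => g.form z z) (hv v)
      have hf0 := congrArg (fun z => g.form z (e 0)) (hv v)
      have h00 := g.form_self (e 0)
      have h11 := g.form_self (e 1)
      simp only [form_add_left, form_smul_left, form_add_right, form_smul_right, h00, h11, ← ha,
        ← hb, ← hc, hb'] at hff hf0
      rw [← mul_star_eq, ← mul_star_eq, ← mul_star_eq, ← g.form_self v, hff, hf0]
      simp only [star_add, star_mul', star_star, star_intCast]
      ring
    exact_mod_cast this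
  rcases hdet with h1 | h1
  · exfalso
    have h3 : ∀ v, 0 ≤ a * g.normSq v := fun v => by
      rw [key, h1]
      have := norm_nonneg (g.form v (e 0))
      have := norm_nonneg (e.repr v 1)
      linarith
    have h4 : a = 0 := by nlinarith [h3 x, h3 y]
    rw [h4] at h1
    have := norm_nonneg b
    linarith
  · by_cases ha0 : a = 0
    · exact ⟨e 0, e.ne_zero 0, by rw [form_self, ← ha, ha0, Int.cast_zero]⟩
    · have h2 : e.repr ((1 - star b) • e 0 + (a : Eisenstein) • e 1) 1 = (a : Eisenstein) := by
        simp
      refine ⟨(1 - star b) • e 0 + (a : Eisenstein) • e 1, fun h0 => ha0 ?_, ?_⟩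
      · rw [h0] at h2
        simpa using h2.symm
      · have h3 := key ((1 - star b) • e 0 + (a : Eisenstein) • e 1)
        have h4 : g.form ((1 - star b) • e 0 + (a : Eisenstein) • e 1) (e 0) = (a : Eisenstein) := by
          simp only [form_add_left, form_smul_left, form_self, ← ha, hb']
          ring
        rw [h2, h1, h4] at h3
        have h5 : g.normSq ((1 - star b) • e 0 + (a : Eisenstein) • e 1) = 0 := by
          apply (mul_eq_zero.1 (h3.trans _)).resolve_left ha0
          ring
        rw [form_self, h5, Int.cast_zero]

/-- An indefinite unimodular lattice is isotropic. -/
theorem IsModular.exists_null [Module.Free Eisenstein N] [Module.Finite Eisenstein N]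
    {g : HermForm N} (hg : g.IsModular 1) {x y : N}
    (hx : 0 < g.normSq x) (hy : g.normSq y < 0) : ∃ v, v ≠ 0 ∧ g.form v v = 0 := by
  obtain ⟨z, hxz, hz⟩ := normSq_pos_sub hx hy
  have hzx : g.form z x = 0 := by rw [← g.star_form, hxz, star_zero]
  by_cases hex : ∃ w, w ≠ 0 ∧ g.form w x = 0 ∧ g.form w z = 0
  · obtain ⟨w, hw0, hwx, hwz⟩ := hex
    by_cases hw : g.normSq w = 0
    · exact ⟨w, hw0, by rw [form_self, hw, Int.cast_zero]⟩
    · exact exists_null_of_orthogonal hx hz hw hxz hwx hwz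
  push Not at hex
  let φ : N →ₗ[Eisenstein] Eisenstein × Eisenstein :=
    { toFun := fun v => (g.form v x, g.form v z), map_add' := by simp, map_smul' := by simp }
  have hφ : Function.Injective φ := by
    rw [← LinearMap.ker_eq_bot, LinearMap.ker_eq_bot']
    intro v hv
    by_contra h0
    exact hex v h0 (congrArg Prod.fst hv) (congrArg Prod.snd hv)
  have h1 : Module.finrank Eisenstein N ≤ 2 := by
    have := LinearMap.finrank_le_finrank_of_injective hφ
    rwa [Module.finrank_prod, Module.finrank_self] at this
  have hli : LinearIndependent Eisenstein ![x, z] := by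
    rw [LinearIndependent.pair_iff]
    intro s t hst
    have e1 := congrArg (fun v => g.form v x) hst
    have e2 := congrArg (fun v => g.form v z) hst
    simp only [form_add_left, form_smul_left, hxz, hzx, form_self] at e1 e2
    simp [hx.ne', hz.ne] at e1 e2
    exact ⟨e1, e2⟩
  have h2 := hli.fintype_card_le_finrank
  simp at h2
  exact hg.exists_null_of_basis_fin_two (Module.finBasisOfFinrankEq Eisenstein N (by omega)) hx hy

theorem IsModular.exists_hyperbolic_pair [Module.Free Eisenstein N] [Module.Finite Eisenstein N]
    {g : HermForm N} (hg : g.IsModular 1) {x y : N}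
    (hx : 0 < g.normSq x) (hy : g.normSq y < 0) : ∃ ρ w, g.form ρ ρ = 0 ∧ g.form ρ w = 1 := by
  obtain ⟨v, hv0, hv⟩ := hg.exists_null hx hy
  obtain ⟨d, ρ, f, hd, hdρ, hf⟩ := exists_eq_smul_functional_eq_one hv0
  obtain ⟨w, hw⟩ := hg.exists_form_eq f
  refine ⟨ρ, w, ?_, by rw [hw, hf, one_mul]⟩
  have h1 := g.normSq_smul d ρ
  have h2 : g.normSq v = 0 := by rw [normSq_eq_iff, hv, Int.cast_zero]
  rw [← hdρ, h2] at h1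
  rw [form_self, (mul_eq_zero.1 h1.symm).resolve_left (norm_pos hd).ne', Int.cast_zero]

/-- Since `ω` has trace -1, adding a multiple of `ρ` to `w` changes its norm by any integer. There
is no parity obstruction, and `w` can be given norm 1. -/
theorem exists_orthogonal_pair_of_hyperbolic_pair {g : HermForm N} {ρ w : N}
    (hρ : g.form ρ ρ = 0) (hρw : g.form ρ w = 1) :
    ∃ e f, g.form e e = 1 ∧ g.form f f = -1 ∧ g.form f e = 0 := by
  have hwρ : g.form w ρ = 1 := by rw [← g.star_form, hρw, star_one]
  set m := g.normSq w - 1 with hm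
  have hω := add_star_eq (m • Eisenstein.ω)
  have h4 : (2 * (m • Eisenstein.ω).re - (m • Eisenstein.ω).im) = -m := by simp [Eisenstein.ω]
  rw [h4] at hω
  have hρρ : g.normSq ρ = 0 := by rw [normSq_eq_iff, hρ, Int.cast_zero]
  have h5 : g.form (w + (m • Eisenstein.ω) • ρ) (w + (m • Eisenstein.ω) • ρ) = 1 := by
    have hww := g.form_self w
    simp only [form_add_left, form_smul_left, form_add_right, form_smul_right, hρ, hρw, hwρ, hww]
    rw [hm] at hω ⊢
    push_cast at hω
    linear_combination hω
  have h6 : g.form ρ (w + (m • Eisenstein.ω) • ρ) = 1 := by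
    rw [form_add_right, form_smul_right, hρ, hρw]; ring
  have h7 : g.form (w + (m • Eisenstein.ω) • ρ) ρ = 1 := by rw [← g.star_form, h6, star_one]
  refine ⟨w + (m • Eisenstein.ω) • ρ, ρ - (w + (m • Eisenstein.ω) • ρ), h5, ?_, ?_⟩
  · rw [form_sub_left, form_sub_right, form_sub_right, h5, h6, h7, hρ]; ring
  · rw [form_sub_left, h5, h6]; ring

/-- The lattice has an orthogonal basis of vectors of norm `1` or `-1`. -/
def IsDiagonalizable (g : HermForm N) : Prop :=
  ∃ (ι : Type) (_ : Fintype ι) (b : Module.Basis ι Eisenstein N),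
    (∀ i j, i ≠ j → g.form (b i) (b j) = 0) ∧ ∀ i, g.form (b i) (b i) = 1 ∨ g.form (b i) (b i) = -1

section split

variable {g : HermForm N} {e : N} {ε : ℤ}

theorem sub_form_smul_mem_perp (hε : ε * ε = 1) (he : g.form e e = ε) (x : N) :
    x - (ε * g.form x e) • e ∈ g.perp e := by
  change g.form _ e = 0
  rw [form_sub_left, form_smul_left, he]
  have : (ε : Eisenstein) * ε = 1 := by exact_mod_cast hε
  linear_combination (-g.form x e) * this

theorem IsModular.restrict_perp (hε : ε * ε = 1) (he : g.form e e = ε)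
    (hg : g.IsModular 1) : (g.restrict (g.perp e)).IsModular 1 where
  dvd _ _ := one_dvd _
  exists_form_eq f := by
    let π : N →ₗ[Eisenstein] g.perp e :=
      { toFun := fun x => ⟨_, sub_form_smul_mem_perp hε he x⟩
        map_add' := fun x y => Subtype.ext (by
          simp only [form_add_left, Submodule.coe_add, mul_add, add_smul]; abel)
        map_smul' := fun a x => Subtype.ext (by
          simp only [form_smul_left, RingHom.id_apply, Submodule.coe_smul, smul_sub, smul_smul]
          congr 2; ring) }
    obtain ⟨y, hy⟩ := hg.exists_form_eq (f ∘ₗ π)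
    refine ⟨π y, fun x => ?_⟩
    have hx : g.form x e = 0 := x.2
    have hπ : π x = x := Subtype.ext (by
      change (x : N) - (ε * g.form x e) • e = x
      rw [hx]; simp)
    have h1 := hy x
    rw [LinearMap.comp_apply, hπ] at h1
    rw [← h1]
    change g.form x (y - (ε * g.form y e) • e) = g.form x y
    rw [form_sub_right, form_smul_right, hx]; ring

/-- The orthogonal decomposition of a lattice into a vector of norm `± 1` and its complement. -/
theorem exists_perp_equiv (hε : ε * ε = 1) (he : g.form e e = ε) :
    ∃ E : (g.perp e × Eisenstein) ≃ₗ[Eisenstein] N,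
    ∀ v, E v = (v.1 : N) + v.2 • e := by
  have hεε : (ε : Eisenstein) * ε = 1 := by exact_mod_cast hε
  let F : (g.perp e × Eisenstein) →ₗ[Eisenstein] N :=
    LinearMap.coprod (g.perp e).subtype (LinearMap.toSpanSingleton Eisenstein N e)
  have hF : ∀ v, F v = (v.1 : N) + v.2 • e := fun v => rfl
  refine ⟨LinearEquiv.ofBijective F ⟨?_, fun x => ?_⟩, hF⟩
  · rw [← LinearMap.ker_eq_bot, LinearMap.ker_eq_bot']
    rintro ⟨x, a⟩ hx
    rw [hF] at hx
    have h0 : g.form (x : N) e = 0 := x.2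
    have h1 := congrArg (fun v => g.form v e) hx
    simp only [form_add_left, form_smul_left, h0, he] at h1
    have ha : a = 0 := by
      simp at h1
      rcases h1 with h1 | h1
      · exact h1
      · rw [h1] at hε; simp at hε
    subst ha
    simp at hx
    simp [hx]
  · exact ⟨(⟨_, sub_form_smul_mem_perp hε he x⟩, ε * g.form x e), by rw [hF]; simp⟩

theorem finrank_perp [Module.Free Eisenstein N] [Module.Finite Eisenstein N]
    (hε : ε * ε = 1) (he : g.form e e = ε) :
    Module.finrank Eisenstein (g.perp e) + 1 = Module.finrank Eisenstein N := by
  obtain ⟨E, -⟩ := exists_perp_equiv hε he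
  rw [← E.finrank_eq, Module.finrank_prod, Module.finrank_self]

theorem IsDiagonalizable.of_perp (hε : ε * ε = 1) (he : g.form e e = ε)
    (h : (g.restrict (g.perp e)).IsDiagonalizable) :
    g.IsDiagonalizable := by
  obtain ⟨ι, _, b, hb, hb1⟩ := h
  obtain ⟨E, hE⟩ := exists_perp_equiv hε he
  let B := (b.prod (Module.Basis.singleton Unit Eisenstein)).map E
  have hl : ∀ i, B (Sum.inl i) = b i := fun i => by simp [B, hE]
  have hr : ∀ i, B (Sum.inr i) = e := fun i => by simp [B, hE]
  have hp : ∀ i, g.form (b i : N) e = 0 := fun i => (b i).2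
  refine ⟨ι ⊕ Unit, inferInstance, B, ?_, ?_⟩
  · rintro (i | i) (j | j) hij
    · rw [hl, hl]; exact hb i j (by simpa using hij)
    · rw [hl, hr, hp]
    · rw [hl, hr, ← g.star_form, hp, star_zero]
    · exact absurd rfl hij
  · rintro (i | i)
    · rw [hl]; exact hb1 i
    · rw [hr, he]
      rcases Int.eq_one_or_neg_one_of_mul_eq_one hε with h | h <;> simp [h]

end split

/-- Polarization: the traces of `⟨x, y⟩` and of `ω⟨x, y⟩` both vanish, which determines both
coordinates. -/
theorem form_eq_zero_of_normSq_eq_zero {g : HermForm N} {K : Submodule Eisenstein N}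
    (hK : ∀ k ∈ K, g.normSq k = 0) {x y : N} (hx : x ∈ K) (hy : y ∈ K) : g.form x y = 0 := by
  have h1 := g.normSq_add x y
  have h2 := g.normSq_add (Eisenstein.ω • x) y
  rw [hK _ (K.add_mem hx hy), hK _ hx, hK _ hy] at h1
  rw [hK _ (K.add_mem (K.smul_mem _ hx) hy), hK _ (K.smul_mem _ hx), hK _ hy, form_smul_left] at h2
  simp [Eisenstein.ω] at h1 h2
  apply QuadraticAlgebra.ext
  · simp; omega
  · simp; omega

/-- A hyperbolic pair yields orthogonal `e`, `f` of norms 1 and -1. One of them is split off so that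
the complement remains indefinite; when neither choice does, `e` and `f` already span the lattice.
-/
theorem isDiagonalizable_aux (d : ℕ) : ∀ {N : Type*} [AddCommGroup N] [Module Eisenstein N]
    [Module.Free Eisenstein N] [Module.Finite Eisenstein N] {g : HermForm N}, g.IsModular 1 →
    ∀ {x y : N}, 0 < g.normSq x → g.normSq y < 0 → Module.finrank Eisenstein N = d →
    g.IsDiagonalizable := by
  induction d with
  | zero =>
    intro N _ _ _ _ g hg x y hx hy hd
    have : Subsingleton N := (Module.finrank_eq_zero_iff_of_free Eisenstein N).1 hd
    rw [Subsingleton.elim x y] at hx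
    omega
  | succ d ih =>
    intro N _ _ _ _ g hg x y hx hy hd
    obtain ⟨ρ, w, hρ, hρw⟩ := hg.exists_hyperbolic_pair hx hy
    obtain ⟨e, f, he, hf, hfe⟩ := exists_orthogonal_pair_of_hyperbolic_pair hρ hρw
    have hef : g.form e f = 0 := by rw [← g.star_form, hfe, star_zero]
    have he' : g.form e e = ((1 : ℤ) : Eisenstein) := by simpa using he
    have hf' : g.form f f = ((-1 : ℤ) : Eisenstein) := by simpa using hf
    have hne : g.normSq e = 1 := g.normSq_eq_iff.2 he'
    have hnf : g.normSq f = -1 := g.normSq_eq_iff.2 hf'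
    by_cases h1 : ∃ k ∈ g.perp e, 0 < g.normSq k
    · obtain ⟨k, hk, hk0⟩ := h1
      refine IsDiagonalizable.of_perp (by norm_num) he' (ih (x := ⟨k, hk⟩) (y := ⟨f, hfe⟩)
        (IsModular.restrict_perp (by norm_num) he' hg) hk0 (by change g.normSq f < 0; omega) ?_)
      have := finrank_perp (by norm_num) he'
      omega
    by_cases h2 : ∃ k ∈ g.perp f, g.normSq k < 0
    · obtain ⟨k, hk, hk0⟩ := h2
      refine IsDiagonalizable.of_perp (by norm_num) hf' (ih (x := ⟨e, hef⟩) (y := ⟨k, hk⟩)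
        (IsModular.restrict_perp (by norm_num) hf' hg) (by change 0 < g.normSq e; omega) hk0 ?_)
      have := finrank_perp (by norm_num) hf'
      omega
    push Not at h1 h2
    -- Now `e^⊥` has no positive norms and `f^⊥` no negative ones, so the form vanishes on the
    -- intersection, which is zero by unimodularity.
    have hK : ∀ k ∈ g.perp e ⊓ g.perp f, g.normSq k = 0 := fun k hk =>
      le_antisymm (h1 k hk.1) (h2 k hk.2)
    refine IsDiagonalizable.of_perp (by norm_num) he' ?_
    have hf'' : (g.restrict (g.perp e)).form ⟨f, hfe⟩ ⟨f, hfe⟩ = ((-1 : ℤ) : Eisenstein) := hf'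
    refine IsDiagonalizable.of_perp (by norm_num) hf'' ?_
    have hsub : Subsingleton ((g.restrict (g.perp e)).perp ⟨f, hfe⟩) := by
      refine ⟨fun a b => ?_⟩
      have hzero : ∀ k : (g.restrict (g.perp e)).perp ⟨f, hfe⟩, k = 0 := by
        rintro ⟨⟨k, hke⟩, hkf⟩
        have hke' : g.form k e = 0 := hke
        have hkf' : g.form k f = 0 := hkf
        have hek : g.form e k = 0 := by rw [← g.star_form, hke', star_zero]
        have hfk : g.form f k = 0 := by rw [← g.star_form, hkf', star_zero]
        have : k = 0 := by
          refine hg.eq_zero (fun v => ?_) one_ne_zero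
          have hmem : v - g.form v e • e + g.form v f • f ∈ g.perp e ⊓ g.perp f := by
            constructor
            · change g.form _ e = 0
              rw [form_add_left, form_sub_left, form_smul_left, form_smul_left, he, hfe]; ring
            · change g.form _ f = 0
              rw [form_add_left, form_sub_left, form_smul_left, form_smul_left, hf, hef]; ring
          have h0 := form_eq_zero_of_normSq_eq_zero hK hmem ⟨hke', hkf'⟩
          rw [form_add_left, form_sub_left, form_smul_left, form_smul_left, hek, hfk] at h0
          simpa using h0
        exact Subtype.ext (Subtype.ext this)
      rw [hzero a, hzero b]
    exact ⟨Empty, inferInstance, Module.Basis.empty _, fun i => i.elim, fun i => i.elim⟩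

/-- Indefinite unimodular lattices are diagonalizable. -/
theorem IsModular.isDiagonalizable [Module.Free Eisenstein N] [Module.Finite Eisenstein N]
    {g : HermForm N} (hg : g.IsModular 1) {x y : N}
    (hx : 0 < g.normSq x) (hy : g.normSq y < 0) : g.IsDiagonalizable :=
  isDiagonalizable_aux _ hg hx hy rfl

theorem IsDiagonalizable.exists_basis {g : HermForm N} (hg : g.IsDiagonalizable) :
    ∃ (p n : ℕ) (b : Module.Basis (Fin p ⊕ Fin n) Eisenstein N), g.HasSignature p n ∧
      (∀ i j, i ≠ j → g.form (b i) (b j) = 0) ∧ (∀ i, g.form (b (Sum.inl i)) (b (Sum.inl i)) = 1) ∧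
      ∀ j, g.form (b (Sum.inr j)) (b (Sum.inr j)) = -1 := by
  obtain ⟨ι, _, b, hb, hb1⟩ := hg
  obtain ⟨p, n, e, hp, hn⟩ := exists_sum_equiv_fin fun i => g.form (b i) (b i) = 1
  have h1 : ∀ i j, i ≠ j → g.form (b.reindex e.symm i) (b.reindex e.symm j) = 0 := fun i j hij => by
    simpa using hb _ _ (e.injective.ne hij)
  have h2 : ∀ i, g.form (b.reindex e.symm (Sum.inl i)) (b.reindex e.symm (Sum.inl i)) = 1 :=
    fun i => by simpa using hp i
  have h3 : ∀ i, g.form (b.reindex e.symm (Sum.inr i)) (b.reindex e.symm (Sum.inr i)) = -1 :=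
    fun i => by simpa using (hb1 _).resolve_left (hn i)
  refine ⟨p, n, b.reindex e.symm, ⟨(b.reindex e.symm).baseChange ℂ, fun i j hij => ?_, fun i => ?_,
    fun i => ?_⟩, h1, h2, h3⟩
  · rw [Module.Basis.baseChange_apply, Module.Basis.baseChange_apply, complexForm_tmul_tmul,
      h1 i j hij]; simp
  · rw [Module.Basis.baseChange_apply, complexForm_tmul_tmul, h2]; simp
  · rw [Module.Basis.baseChange_apply, complexForm_tmul_tmul, h3]; simp

end HermForm

end

/-! ### Lagrangians modulo `θ` and reflections -/

noncomputable section

namespace HermForm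

open Eisenstein

variable {N : Type*} [AddCommGroup N] [Module Eisenstein N]

/-- The submodule is its own orthogonal complement modulo `θ`. -/
def IsLagrangian (g : HermForm N) (Λ : Submodule Eisenstein N) : Prop :=
  ∀ x, x ∈ Λ ↔ ∀ y ∈ Λ, θ ∣ g.form x y

theorem IsLagrangian.smul_mem {g : HermForm N} {Λ : Submodule Eisenstein N} (hΛ : g.IsLagrangian Λ)
    (z : N) : θ • z ∈ Λ :=
  (hΛ _).2 fun y _ => by rw [form_smul_left]; exact dvd_mul_right _ _

theorem IsLagrangian.add_smul_mem_iff {g : HermForm N} {Λ : Submodule Eisenstein N}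
    (hΛ : g.IsLagrangian Λ) {x : N} (z : N) : x + θ • z ∈ Λ ↔ x ∈ Λ :=
  Λ.add_mem_iff_left (hΛ.smul_mem z)

theorem IsLagrangian.comap {M : Type*} [AddCommGroup M] [Module Eisenstein M] {h : HermForm M}
    {g : HermForm N} {Λ : Submodule Eisenstein N} (hΛ : g.IsLagrangian Λ) (e : Isometry h g) :
    h.IsLagrangian (Λ.comap e.toLinearEquiv.toLinearMap) := by
  intro x
  rw [Submodule.mem_comap]
  refine (hΛ _).trans ⟨fun H y hy => ?_, fun H y hy => ?_⟩
  · rw [← e.map_form]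
    exact H _ hy
  · have := H (e.toLinearEquiv.symm y) (by simpa using hy)
    rw [← e.map_form, LinearEquiv.apply_symm_apply] at this
    exact this

theorem residue_normSq_cast (g : HermForm N) (x : N) :
    ((g.normSq x : ℤ) : ZMod 3) = residue (g.form x x) := by
  rw [form_self, map_intCast]

theorem three_dvd_iff {n : ℤ} : 3 ∣ n ↔ (n : ZMod 3) = 0 :=
  (ZMod.intCast_zmod_eq_zero_iff_dvd n 3).symm

/-- A norm prescribed modulo 3 is attained exactly within a class modulo `θ`. Adding a multiple of
`θw` makes the pairing with `ρ` equal to `1`, `-1` or `θ`; adding `θaρ` then shifts the norm by an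
arbitrary multiple of 3. -/
theorem exists_add_smul_normSq_eq {g : HermForm N} {ρ w : N} (hρ : g.form ρ ρ = 0)
    (hρw : g.form ρ w = 1) (r : N) {t : ℤ} (ht : ((g.normSq r : ℤ) : ZMod 3) = t) :
    ∃ z, g.normSq (r + θ • z) = t := by
  have hwρ : g.form w ρ = 1 := by rw [← g.star_form, hρw, star_one]
  obtain ⟨b, hb⟩ : ∃ b, g.form r ρ + θ * b = 1 ∨ g.form r ρ + θ * b = -1 ∨
      g.form r ρ + θ * b = θ := by
    have h3 : ∀ c : ZMod 3, c = 0 ∨ c = 1 ∨ c = -1 := by decide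
    rcases h3 (residue (g.form r ρ)) with h | h | h
    · obtain ⟨b, hb⟩ := θ_dvd_iff.2 h
      exact ⟨1 - b, Or.inr (Or.inr (by rw [hb]; ring))⟩
    · obtain ⟨b, hb⟩ : θ ∣ g.form r ρ - 1 := θ_dvd_iff.2 (by rw [map_sub, h, map_one, sub_self])
      exact ⟨-b, Or.inl (by linear_combination hb)⟩
    · obtain ⟨b, hb⟩ : θ ∣ g.form r ρ + 1 :=
        θ_dvd_iff.2 (by rw [map_add, h, map_one, neg_add_cancel])
      exact ⟨-b, Or.inr (Or.inl (by linear_combination hb))⟩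
  set s := r + (θ * b) • w with hs
  have hsρ : g.form s ρ = g.form r ρ + θ * b := by
    rw [hs, form_add_left, form_smul_left, hwρ, mul_one]
  rw [← hsρ] at hb
  obtain ⟨m, hm⟩ : 3 ∣ g.normSq s - t := by
    rw [three_dvd_iff]
    push_cast
    rw [← ht, residue_normSq_cast, residue_normSq_cast, hs]
    simp only [form_add_left, form_smul_left, form_add_right, form_smul_right]
    simp only [map_add, map_mul, star_mul', residue_star, residue_θ]
    ring
  obtain ⟨a, ha⟩ : ∃ a : Eisenstein, (a * g.form ρ s).im = m := by
    rw [← g.star_form]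
    rcases hb with h | h | h
    · exact ⟨⟨0, m⟩, by rw [h]; simp⟩
    · exact ⟨⟨0, -m⟩, by rw [h]; simp⟩
    · exact ⟨⟨0, m⟩, by rw [h, star_θ, θ_eq]; simp; ring⟩
  refine ⟨b • w + a • ρ, ?_⟩
  have h1 : r + θ • (b • w + a • ρ) = (θ * a) • ρ + s := by rw [hs]; module
  have hρρ : g.normSq ρ = 0 := by rw [normSq_eq_iff, hρ, Int.cast_zero]
  have h2 : 2 * (θ * (a * g.form ρ s)).re - (θ * (a * g.form ρ s)).im = -3 * m := by
    rw [← ha, θ_eq]; simp; ring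
  rw [h1, normSq_add, normSq_smul, hρρ, form_smul_left, mul_assoc, h2]
  linarith

/-- The reflection in a vector of norm `± 1`. -/
def reflection (g : HermForm N) (r : N) (ε : ℤ) (hε : ε * ε = 1) (hr : g.form r r = ε) :
    Isometry g g :=
  have hεε : (ε : Eisenstein) * ε = 1 := by exact_mod_cast hε
  { toLinearEquiv := LinearEquiv.ofInvolutive
      { toFun := fun v => v - (2 * ε * g.form v r) • r
        map_add' := fun x y => by rw [form_add_left]; module
        map_smul' := fun a x => by rw [form_smul_left, RingHom.id_apply]; module }
      (fun v => by
        change v - (2 * ε * g.form v r) • r -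
          (2 * ε * g.form (v - (2 * ε * g.form v r) • r) r) • r = v
        rw [form_sub_left, form_smul_left, hr, sub_sub, ← add_smul]
        have : (2 * ε * g.form v r + 2 * ε * (g.form v r - 2 * ε * g.form v r * ε) :
            Eisenstein) = 0 := by
          linear_combination (-4 * ε * g.form v r) * hεε
        rw [this, zero_smul, sub_zero])
    map_form' := fun x y => by
      change g.form (x - (2 * ε * g.form x r) • r) (y - (2 * ε * g.form y r) • r) = g.form x y
      simp only [form_sub_left, form_sub_right, form_smul_left, form_smul_right, hr, star_mul',
        g.star_form, star_intCast, star_ofNat]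
      linear_combination (4 * ε * g.form x r * g.form r y) * hεε }

theorem reflection_reflection (g : HermForm N) (r : N) (ε : ℤ) (hε : ε * ε = 1)
    (hr : g.form r r = ε) (v : N) :
    (g.reflection r ε hε hr).toLinearEquiv ((g.reflection r ε hε hr).toLinearEquiv v) = v :=
  (g.reflection r ε hε hr).toLinearEquiv.apply_symm_apply v

/-- If the lattice contains a hyperbolic plane, then a reflection moves one Lagrangian
closer to another one. -/
theorem IsLagrangian.exists_reflection {g : HermForm N} {ρ w : N} (hρ : g.form ρ ρ = 0)
    (hρw : g.form ρ w = 1) {Λ₁ Λ₂ : Submodule Eisenstein N} (h₁ : g.IsLagrangian Λ₁)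
    (h₂ : g.IsLagrangian Λ₂) (hne : Λ₁ ≠ Λ₂) :
    ∃ s : Isometry g g, (∀ v, s.toLinearEquiv (s.toLinearEquiv v) = v) ∧
      Λ₁ ⊓ Λ₂ < Λ₁.comap s.toLinearEquiv.toLinearMap ⊓ Λ₂ := by
  obtain ⟨x, hx, y, hy, hxy⟩ : ∃ x ∈ Λ₁, ∃ y ∈ Λ₂, ¬ θ ∣ g.form x y := by
    by_contra! hcon
    apply hne
    apply le_antisymm
    · exact fun x hx => (h₂ x).2 fun y hy => hcon x hx y hy
    · intro y hy
      refine (h₁ y).2 fun x hx => ?_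
      rw [θ_dvd_iff, ← g.star_form, residue_star, ← θ_dvd_iff]
      exact hcon x hx y hy
  rw [θ_dvd_iff] at hxy
  have hyx : residue (g.form y x) = residue (g.form x y) := by
    rw [← g.star_form, residue_star]
  have hxx := θ_dvd_iff.1 ((h₁ x).1 hx x hx)
  have hyy := θ_dvd_iff.1 ((h₂ y).1 hy y hy)
  have hthree : (3 : ZMod 3) = 0 := rfl
  obtain ⟨ε, hε, hεd⟩ : ∃ ε : ℤ, ε * ε = 1 ∧ (ε : ZMod 3) = residue (g.form x y) := by
    have h3 : ∀ c : ZMod 3, c = 0 ∨ c = 1 ∨ c = -1 := by decide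
    rcases (h3 (residue (g.form x y))).resolve_left hxy with h | h
    · exact ⟨1, by norm_num, by rw [h]; simp⟩
    · exact ⟨-1, by norm_num, by rw [h]; simp⟩
  have hεε : (ε : ZMod 3) * ε = 1 := by exact_mod_cast congrArg (Int.cast : ℤ → ZMod 3) hε
  -- Modulo `θ`, `x` and `y` are null, so `x - y` has norm `-2⟨x, y⟩ = ⟨x, y⟩ = ε` there; it lifts
  -- to a vector `r` of norm exactly `ε`.
  obtain ⟨z, hz⟩ := exists_add_smul_normSq_eq hρ hρw (x - y) (t := ε) (by
    rw [residue_normSq_cast]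
    simp only [form_sub_left, form_sub_right]
    simp only [map_sub, hxx, hyy, hyx, ← hεd]
    linear_combination (-ε : ZMod 3) * hthree)
  set r := x - y + θ • z with hr
  have hres : ∀ v, residue (g.form v r) = residue (g.form v x) - residue (g.form v y) := by
    intro v
    rw [hr, form_add_right, form_sub_right, form_smul_right, map_add, map_mul, residue_star,
      residue_θ, map_sub]
    ring
  set s := g.reflection r ε hε (g.normSq_eq_iff.1 hz) with hs
  have hsapp : ∀ v, s.toLinearEquiv v = v - (2 * ε * g.form v r) • r := fun v => rfl
  have hss : ∀ v, s.toLinearEquiv (s.toLinearEquiv v) = v := fun v =>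
    g.reflection_reflection r ε hε _ v
  refine ⟨s, hss, lt_of_le_of_ne ?_ fun heq => ?_⟩
  -- Elements of both Lagrangians are orthogonal to `x` and `y` modulo `θ`, so the reflection fixes
  -- them modulo `θ`.
  · rintro v ⟨hv1, hv2⟩
    refine ⟨?_, hv2⟩
    have h0 : θ ∣ g.form v r := by
      rw [θ_dvd_iff, hres, θ_dvd_iff.1 ((h₁ v).1 hv1 x hx), θ_dvd_iff.1 ((h₂ v).1 hv2 y hy),
        sub_zero]
    obtain ⟨c, hc⟩ := h0
    have : s.toLinearEquiv v = v + θ • (-(2 * ε * c) • r) := by rw [hsapp, hc]; module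
    change s.toLinearEquiv v ∈ Λ₁
    rwa [this, h₁.add_smul_mem_iff]
  -- Modulo `θ` the coefficient is `-2ε² = 1`, so `x` is sent to `x - r`, that is, to `y`. The new
  -- intersection gains `y`, which is not in `Λ₁`.
  · obtain ⟨c, hc⟩ : θ ∣ 2 * ε * g.form x r - 1 := by
      rw [θ_dvd_iff, map_sub, map_mul, map_mul, map_intCast, hres, hxx, ← hεd, map_ofNat, map_one]
      linear_combination (-2) * hεε - hthree
    have h0 : s.toLinearEquiv x = y + θ • (-z - c • r) := by
      have h1 : 2 * ε * g.form x r = 1 + θ * c := by linear_combination hc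
      rw [hsapp, h1]
      have h2 : y = x - r + θ • z := by rw [hr]; module
      rw [h2]
      module
    have hymem : y ∈ Λ₁.comap s.toLinearEquiv.toLinearMap ⊓ Λ₂ := by
      refine ⟨?_, hy⟩
      change s.toLinearEquiv y ∈ Λ₁
      have h1 := hss x
      rw [h0, map_add, map_smul] at h1
      rw [← h₁.add_smul_mem_iff (s.toLinearEquiv (-z - c • r)), h1]
      exact hx
    rw [← heq] at hymem
    exact hxy (θ_dvd_iff.1 ((h₁ x).1 hx y hymem.1))

/-- The automorphism group of a lattice containing a hyperbolic plane is transitive on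
Lagrangians. -/
theorem IsLagrangian.exists_isometry [Module.Finite Eisenstein N] {g : HermForm N} {ρ w : N}
    (hρ : g.form ρ ρ = 0) (hρw : g.form ρ w = 1) {Λ₂ : Submodule Eisenstein N}
    (h₂ : g.IsLagrangian Λ₂) : ∀ {Λ₁ : Submodule Eisenstein N}, g.IsLagrangian Λ₁ →
    ∃ e : Isometry g g, ∀ v, v ∈ Λ₁ ↔ e.toLinearEquiv v ∈ Λ₂ := by
  suffices H : ∀ I : Submodule Eisenstein N, ∀ Λ₁ : Submodule Eisenstein N, I = Λ₁ ⊓ Λ₂ →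
      g.IsLagrangian Λ₁ → ∃ e : Isometry g g, ∀ v, v ∈ Λ₁ ↔ e.toLinearEquiv v ∈ Λ₂ from
    fun {Λ₁} h₁ => H _ Λ₁ rfl h₁
  intro I
  -- The intersection grows strictly with each reflection, and ascending chains of submodules stop.
  induction I using WellFoundedGT.induction with
  | ind I ih =>
    intro Λ₁ hI h₁
    by_cases hne : Λ₁ = Λ₂
    · subst hne
      exact ⟨{ LinearEquiv.refl _ _ with map_form' := fun _ _ => rfl }, fun v => Iff.rfl⟩
    obtain ⟨s, hss, hlt⟩ := IsLagrangian.exists_reflection hρ hρw h₁ h₂ hne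
    obtain ⟨e, he⟩ := ih _ (hI ▸ hlt) _ rfl (h₁.comap s)
    refine ⟨s.trans e, fun v => ?_⟩
    have h1 := he (s.toLinearEquiv v)
    rw [Submodule.mem_comap] at h1
    change s.toLinearEquiv (s.toLinearEquiv v) ∈ Λ₁ ↔ _ at h1
    rw [hss] at h1
    exact h1

/-! ### From `θ`-modular to unimodular lattices -/

variable {L : Type*} [AddCommGroup L] [Module Eisenstein L]
  [Module.Free Eisenstein L] [Module.Finite Eisenstein L]

/-- A `θ`-modular lattice contains a unimodular lattice (for the form divided by `3`) in which it
embeds as a Lagrangian after multiplication by `θ`. -/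
theorem IsModular.exists_unimodular {h : HermForm L} (hh : h.IsModular θ) :
    ∃ (K : Submodule Eisenstein L) (g : HermForm K) (j : L →ₗ[Eisenstein] K),
      g.IsModular 1 ∧ (∀ x y : K, h.form x y = (3 : ℤ) * g.form x y) ∧
      (∀ x y, g.form (j x) (j y) = h.form x y) ∧ g.IsLagrangian (LinearMap.range j) := by
  have h3 : ((3 : ℤ) : Eisenstein) = -(θ * θ) := by rw [θ_mul_θ]; norm_num
  have h30 : ((3 : ℤ) : Eisenstein) ≠ 0 := by exact_mod_cast (by norm_num : (3 : ℤ) ≠ 0)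
  let S : Set (Submodule Eisenstein L) :=
    {K | (∀ x, θ • x ∈ K) ∧ ∀ x ∈ K, ∀ y ∈ K, ((3 : ℤ) : Eisenstein) ∣ h.form x y}
  have hS : S.Nonempty := by
    refine ⟨LinearMap.range (LinearMap.lsmul Eisenstein L θ), fun x => ⟨x, rfl⟩, ?_⟩
    rintro _ ⟨x, rfl⟩ _ ⟨y, rfl⟩
    change _ ∣ h.form (θ • x) (θ • y)
    rw [form_smul_left, form_smul_right, star_θ, h3]
    exact ⟨h.form x y, by ring⟩
  obtain ⟨K, ⟨hKθ, hK3⟩, hKmax⟩ := wellFounded_gt.has_min S hS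
  obtain ⟨g, hg⟩ := (h.restrict K).exists_div (n := 3) (by norm_num)
    fun x y => hK3 x x.2 y y.2
  have hg : ∀ x y : K, h.form x y = (3 : ℤ) * g.form x y := hg
  let j : L →ₗ[Eisenstein] K := (LinearMap.lsmul Eisenstein L θ).codRestrict K hKθ
  have hj : ∀ x, (j x : L) = θ • x := fun x => rfl
  -- Maximality makes `K` its own orthogonal complement modulo 3: the norm of `y` is an integer
  -- divisible by `θ`, hence by 3, so `y` could be adjoined to `K`.
  have hmem : ∀ y, (∀ x ∈ K, ((3 : ℤ) : Eisenstein) ∣ h.form x y) → y ∈ K := by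
    intro y hy
    have hyy : ((3 : ℤ) : Eisenstein) ∣ h.form y y := by
      have := hh.dvd y y
      rw [form_self, θ_dvd_intCast] at this
      obtain ⟨c, hc⟩ := this
      exact ⟨c, by rw [form_self, hc, Int.cast_mul]⟩
    have hstar : ∀ a b, ((3 : ℤ) : Eisenstein) ∣ h.form a b → ((3 : ℤ) : Eisenstein) ∣ h.form b a := by
      rintro a b ⟨c, hc⟩
      exact ⟨star c, by rw [← h.star_form, hc, star_mul', star_intCast]⟩
    have hsup : K ⊔ Submodule.span Eisenstein {y} ∈ S := by
      refine ⟨fun x => Submodule.mem_sup_left (hKθ x), fun u hu v hv => ?_⟩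
      obtain ⟨a, ha, b, hb, rfl⟩ := Submodule.mem_sup.1 hu
      obtain ⟨c, hc, d, hd, rfl⟩ := Submodule.mem_sup.1 hv
      obtain ⟨s, rfl⟩ := Submodule.mem_span_singleton.1 hb
      obtain ⟨t, rfl⟩ := Submodule.mem_span_singleton.1 hd
      simp only [form_add_left, form_smul_left, form_add_right, form_smul_right]
      have e1 := hK3 a ha c hc
      have e2 := hy a ha
      have e3 := hstar _ _ (hy c hc)
      exact dvd_add (dvd_add e1 (e3.mul_left _)) ((dvd_add e2 (hyy.mul_left _)).mul_left _)
    by_contra hyK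
    apply hKmax _ hsup
    refine lt_of_le_of_ne le_sup_left fun heq => hyK ?_
    rw [heq]
    exact Submodule.mem_sup_right (Submodule.mem_span_singleton_self y)
  have hgj : ∀ x y, g.form (j x) (j y) = h.form x y := by
    intro x y
    apply mul_left_cancel₀ h30
    rw [← hg, hj, hj, form_smul_left, form_smul_right, star_θ, h3]
    ring
  refine ⟨K, g, j, ⟨fun _ _ => one_dvd _, fun f => ?_⟩, hg, hgj, fun x => ⟨?_, fun hx => ?_⟩⟩
  · obtain ⟨y, hy⟩ := hh.exists_form_eq (f ∘ₗ j)
    have hxy : ∀ x : K, h.form x y = -((3 : ℤ) : Eisenstein) * f x := by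
      intro x
      apply mul_left_cancel₀ θ_ne_zero
      have h1 := hy (θ • (x : L))
      have h2 : j (θ • (x : L)) = (θ * θ) • x := by
        apply Subtype.ext
        rw [hj, smul_smul]; rfl
      rw [form_smul_left, LinearMap.comp_apply, h2, map_smul, smul_eq_mul] at h1
      rw [h1, h3]
      ring
    have hyK : y ∈ K := hmem y fun x hx => ⟨-f ⟨x, hx⟩, by rw [hxy ⟨x, hx⟩]; ring⟩
    refine ⟨-⟨y, hyK⟩, fun x => ?_⟩
    apply mul_left_cancel₀ h30
    rw [← hg]
    change h.form (x : L) (-y) = _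
    rw [map_neg, hxy]
    ring
  · rintro ⟨u, rfl⟩ _ ⟨v, rfl⟩
    rw [hgj]
    exact hh.dvd u v
  -- Pairing with `θL` in `θE` for the form over 3 means pairing with all of `L` in `3E`; by
  -- modularity such an `x` lies in `θL`.
  · have hx' : ∀ z, ((3 : ℤ) : Eisenstein) ∣ h.form z x := by
      intro z
      obtain ⟨c, hc⟩ := hx (j z) ⟨z, rfl⟩
      have h1 := hg x (j z)
      rw [hc, hj, form_smul_right, star_θ] at h1
      have h2 : h.form x z = -((3 : ℤ) : Eisenstein) * c := by
        apply mul_left_cancel₀ θ_ne_zero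
        linear_combination -h1
      exact ⟨-star c, by rw [← h.star_form, h2, star_mul', star_neg, star_intCast]; ring⟩
    obtain ⟨f, hf⟩ := exists_functional_div h30
      { toFun := fun z => h.form z x, map_add' := by simp, map_smul' := by simp } hx'
    have hf : ∀ z, h.form z x = (3 : ℤ) * f z := hf
    obtain ⟨y, hy⟩ := hh.exists_form_eq f
    refine ⟨y, Subtype.ext ?_⟩
    rw [hj, ← sub_eq_zero]
    refine hh.eq_zero (fun z => ?_) θ_ne_zero
    rw [form_sub_right, form_smul_right, hy, hf, star_θ, h3]
    ring

end HermForm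

end

/-! ### Uniqueness of indefinite `θ`-modular lattices -/

noncomputable section

namespace HermForm

open Eisenstein

variable {L : Type*} [AddCommGroup L] [Module Eisenstein L]
  [Module.Free Eisenstein L] [Module.Finite Eisenstein L]
variable {M : Type*} [AddCommGroup M] [Module Eisenstein M]
  [Module.Free Eisenstein M] [Module.Finite Eisenstein M]

/-- An indefinite `θ`-modular lattice is isometric to a Lagrangian in a diagonal
unimodular lattice of the same signature. -/
theorem IsModular.exists_diagonal {h : HermForm L} (hh : h.IsModular θ) {p n : ℕ}
    (hs : h.HasSignature p n) (hp : 0 < p) (hn : 0 < n) :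
    ∃ (K : Submodule Eisenstein L) (g : HermForm K) (j : L →ₗ[Eisenstein] K)
      (b : Module.Basis (Fin p ⊕ Fin n) Eisenstein K),
      Function.Injective j ∧ (∀ x y, g.form (j x) (j y) = h.form x y) ∧
      g.IsLagrangian (LinearMap.range j) ∧ (∃ ρ w, g.form ρ ρ = 0 ∧ g.form ρ w = 1) ∧
      (∀ i j, i ≠ j → g.form (b i) (b j) = 0) ∧ (∀ i, g.form (b (Sum.inl i)) (b (Sum.inl i)) = 1) ∧
      ∀ i, g.form (b (Sum.inr i)) (b (Sum.inr i)) = -1 := by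
  obtain ⟨K, g, j, hg, hgh, hj, hL⟩ := hh.exists_unimodular
  have hnorm : ∀ x, g.normSq (j x) = h.normSq x := fun x => by rw [normSq, hj, normSq]
  have hinj : Function.Injective j := by
    rw [← LinearMap.ker_eq_bot, LinearMap.ker_eq_bot']
    exact fun x hx => hh.eq_zero (fun y => by rw [← hj, hx, map_zero]) θ_ne_zero
  obtain ⟨x, hx⟩ := hs.exists_normSq_pos hp
  obtain ⟨y, hy⟩ := hs.exists_normSq_neg hn
  rw [← hnorm] at hx hy
  obtain ⟨p', n', b, hs', h0, h1, h2⟩ := (hg.isDiagonalizable hx hy).exists_basis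
  -- The embedding `j` gives `p ≤ p'`, the inclusion of `K` in `L`, with factor 3, gives `p' ≤ p`,
  -- and the ranks agree.
  have e1 := hs.le_of_map hs' j one_pos (fun x y => by rw [hj]; simp)
  have e2 := hs'.le_of_map hs K.subtype (c := 3) (by norm_num) hgh
  have e3 := LinearMap.finrank_le_finrank_of_injective hinj
  have e4 := LinearMap.finrank_le_finrank_of_injective K.injective_subtype
  rw [hs.finrank_eq, hs'.finrank_eq] at e3 e4
  obtain rfl : p' = p := by omega
  obtain rfl : n' = n := by omega
  exact ⟨K, g, j, b, hinj, hj, hL, hg.exists_hyperbolic_pair hx hy, h0, h1, h2⟩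

theorem nonempty_isometry_of_basis {L M ι : Type*} [AddCommGroup L] [Module Eisenstein L]
    [AddCommGroup M] [Module Eisenstein M] [Fintype ι] {h : HermForm L} {k : HermForm M}
    (b : Module.Basis ι Eisenstein L) (c : Module.Basis ι Eisenstein M)
    (hbc : ∀ i j, h.form (b i) (b j) = k.form (c i) (c j)) : Nonempty (Isometry h k) := by
  refine ⟨{ b.equiv c (Equiv.refl ι) with map_form' := fun x y => ?_ }⟩
  change k.form (b.equiv c (Equiv.refl ι) x) (b.equiv c (Equiv.refl ι) y) = h.form x y
  rw [← b.sum_repr x, ← b.sum_repr y]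
  simp only [map_sum, map_smul, Module.Basis.equiv_apply, Equiv.refl_apply, LinearMap.sum_apply,
    LinearMap.smul_apply, LinearMap.map_smulₛₗ, hbc]

/-- Uniqueness of indefinite `θ`-modular lattices of given signature. -/
theorem IsModular.nonempty_isometry {h : HermForm L} {k : HermForm M} (hh : h.IsModular θ)
    (hk : k.IsModular θ) {p n : ℕ} (hs : h.HasSignature p n) (ks : k.HasSignature p n)
    (hp : 0 < p) (hn : 0 < n) : Nonempty (Isometry h k) := by
  obtain ⟨K₁, g₁, j₁, b₁, hinj₁, hj₁, hL₁, -, h0, h1, h2⟩ := hh.exists_diagonal hs hp hn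
  obtain ⟨K₂, g₂, j₂, b₂, hinj₂, hj₂, hL₂, ⟨ρ, w, hρ, hρw⟩, k0, k1, k2⟩ :=
    hk.exists_diagonal ks hp hn
  obtain ⟨φ⟩ := nonempty_isometry_of_basis (h := g₁) (k := g₂) b₁ b₂ (fun i j => by
    by_cases hij : i = j
    · subst hij
      rcases i with i | i
      · rw [h1, k1]
      · rw [h2, k2]
    · rw [h0 i j hij, k0 i j hij])
  -- Both unimodular lattices have the same diagonal form; after identifying them by `φ`, an
  -- automorphism carries one Lagrangian to the other, and the Lagrangians are the original
  -- lattices.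
  obtain ⟨e, he⟩ := IsLagrangian.exists_isometry hρ hρw hL₂ (hL₁.comap φ.symm)
  let ψ := φ.trans e
  have hψ : ∀ v, v ∈ LinearMap.range j₁ ↔ ψ.toLinearEquiv v ∈ LinearMap.range j₂ := fun v => by
    have h1 := he (φ.toLinearEquiv v)
    rw [Submodule.mem_comap] at h1
    change φ.toLinearEquiv.symm (φ.toLinearEquiv v) ∈ _ ↔ _ at h1
    rwa [LinearEquiv.symm_apply_apply] at h1
  have hmap : (LinearMap.range j₁).map ψ.toLinearEquiv.toLinearMap = LinearMap.range j₂ := by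
    ext v
    constructor
    · rintro ⟨u, hu, rfl⟩
      exact (hψ u).1 hu
    · intro hv
      refine ⟨ψ.toLinearEquiv.symm v, (hψ _).2 ?_, ?_⟩
      · rwa [LinearEquiv.apply_symm_apply]
      · exact ψ.toLinearEquiv.apply_symm_apply v
  let F := ((LinearEquiv.ofInjective j₁ hinj₁).trans
    (ψ.toLinearEquiv.ofSubmodules _ _ hmap)).trans (LinearEquiv.ofInjective j₂ hinj₂).symm
  have hF : ∀ x, j₂ (F x) = ψ.toLinearEquiv (j₁ x) := fun x => by
    have := LinearEquiv.apply_symm_apply (LinearEquiv.ofInjective j₂ hinj₂)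
      (ψ.toLinearEquiv.ofSubmodules _ _ hmap (LinearEquiv.ofInjective j₁ hinj₁ x))
    exact congrArg Subtype.val this
  refine ⟨{ F with map_form' := fun x y => ?_ }⟩
  change k.form (F x) (F y) = h.form x y
  rw [← hj₂, hF, hF, ψ.map_form, hj₁]

/-- Uniqueness identifies `h` with the sum of a hyperbolic plane and `k`, and `ρ` is the first basis
vector of the plane. Uniqueness is needed only for this sum, which is indefinite even when `k` is
definite or zero. -/
theorem IsModular.exists_isometry_quotForm {h : HermForm M} {k : HermForm L}
    (hh : h.IsModular θ) (hk : k.IsModular θ) {p n : ℕ} (hs : h.HasSignature (p + 1) (n + 1))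
    (ks : k.HasSignature p n) :
    ∃ ρ : M, h.IsPrimitiveNull ρ ∧ Nonempty (Isometry (h.quotForm ρ) k) := by
  obtain ⟨e⟩ := (isModular_hyp_iff.2 hk).nonempty_isometry hh ks.hyp hs p.succ_pos n.succ_pos
  exact ⟨_, e.isPrimitiveNull, e.nonempty_quotForm⟩

end HermForm

end
-- The three claims
theorem lemma2 {M : Type*} [AddCommGroup M] [Module Eisenstein M]
    [Module.Free Eisenstein M] [Module.Finite Eisenstein M] (h : HermForm M)
    (p n : ℕ) (hp : 0 < p) (hn : 0 < n) (hpn : (p : ℤ) ≡ (n : ℤ) [ZMOD 4])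
    (hsig : h.HasSignature p n) (hdual : h.IsThetaSelfDual) :
    (∀ ρ : M, h.IsPrimitiveNull ρ →
      Module.Free Eisenstein (h.Quot ρ) ∧ Module.Finite Eisenstein (h.Quot ρ) ∧
      (h.quotForm ρ).HasSignature (p - 1) (n - 1) ∧ (h.quotForm ρ).IsThetaSelfDual) ∧
    (∀ {L : Type*} [AddCommGroup L] [Module Eisenstein L]
      [Module.Free Eisenstein L] [Module.Finite Eisenstein L] (k : HermForm L),
      k.HasSignature (p - 1) (n - 1) → k.IsThetaSelfDual →
      ∃ ρ : M, h.IsPrimitiveNull ρ ∧ Nonempty (HermForm.Isometry (h.quotForm ρ) k)) ∧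
    (∀ ρ₁ ρ₂ : M, h.IsPrimitiveNull ρ₁ → h.IsPrimitiveNull ρ₂ →
      ((∃ g ∈ h.aut, g ρ₁ = ρ₂) ↔
        Nonempty (HermForm.Isometry (h.quotForm ρ₁) (h.quotForm ρ₂)))) := by
  have hm := (HermForm.isThetaSelfDual_iff hsig).1 hdual
  refine ⟨fun ρ hρ => ?_, fun {L} _ _ _ _ k hk hkd => ?_,
    fun ρ₁ ρ₂ h₁ h₂ => hm.exists_mem_aut_iff h₁ h₂⟩
  · have hfree := hm.free_quot hρ
    have hs := hm.hasSignature_quotForm hsig hρ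
    obtain ⟨e, -⟩ := hm.exists_isometry_hyp hρ
    exact ⟨hfree, inferInstance, hs, (HermForm.isThetaSelfDual_iff hs).2
      (HermForm.isModular_hyp_iff.1 (e.symm.isModular hm))⟩
  -- Writing `p` and `n` as successors makes the truncated differences `p - 1` and `n - 1` genuine.
  · obtain ⟨p, rfl⟩ := Nat.exists_eq_add_one_of_ne_zero hp.ne'
    obtain ⟨n, rfl⟩ := Nat.exists_eq_add_one_of_ne_zero hn.ne'
    exact hm.exists_isometry_quotForm ((HermForm.isThetaSelfDual_iff hk).1 hkd) hsig hk
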